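/- Let $p\ge 3$ be a prime, let $\mathcal K$ be a complete non-Archimedean field of characteristic $p$, and let $\lambda\in\mathcal K$ satisfy $|1-\lambda|<1$ and not be a root of unity. Let $$f(z)=z\Big(\lambda+\sum_{i\ge 1}a_iz^i\Big)\in\mathcal K[[z]]$$ be locally analytic at $0$ (i.e. have positive radius of convergence), with $a_i\neq 0$ for at least one $i\ge 1$. Put $a_0=\lambda$, $\mu=\lambda-1$, $\mathrm{val}_\mu(x)=\ln|x|/\ln|\mu|$ for $x\neq0$ and $\mathrm{val}_\mu(0)=+\infty$, $u=\gcd\{i\ge 1: a_i\ne 0\}$ and $\tau=\mathrm{val}_p(u)$, the exponent of $p$ in $u$. For integers $0\le r<s$ let $I(r,s)$ be the set of $\alpha=(\alpha_0,\dots,\alpha_{s-r})\in\mathbb N^{s-r+1}$ with $\sum_i\alpha_i=r+1$, $\sum_i i\alpha_i=s-r$, and $\alpha_i=0$ whenever $u\nmid i$, and put $$\Phi(r,s)=\frac{1}{\lambda(1-\lambda^s)}\sum_{\alpha\in I(r,s)}\binom{r+1}{\alpha_0,\dots,\alpha_{s-r}}\prod_{i=0}^{s-r}a_i^{\alpha_i}\in\mathcal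 K .$$ For $k\ge 0$ and $0\le r<s$ put $$\phi_k(r,s)=\sum_{\beta}\ \prod_{j=0}^{t-1}\Phi(u\beta_j,u\beta_{j+1}),\qquad \psi_k(r,s)=\phi_k(r,s)\,\frac{1-\lambda^{us}}{(1-\lambda^{p^{k+\tau}})\lambda^{us-1}},$$ where $\beta$ runs over all integer sequences $r=\beta_0<\beta_1<\dots<\beta_t=s$ with $t\ge 1$ such that $p^k\nmid\beta_j$ for $1\le j\le t-1$. For $p^k$-divisible integers $0\le r<s$ put $M_k(r,s)=\mathrm{val}_\mu(\psi_k(r,s))/(s-r)$, and let $M_k$ be the infimum of $M_k(r,s)$ over all such $r,s$. For $k\ge 1$, call $f$ $k$-dominant if $$\min_{1\le d\le p-1}M_k(0,dp^k)\ \le\ \min_{0\le \ell\le k-1}M_\ell\;-\;p^{\tau-1}.$$ If $f$ is $k$-dominant for some integer $k\ge1$, then $f$ is not locally linearizable at $0$; that is, there is no locally analytic (at $0$) power series $h(z)=z\sum_{n\ge 0}b_nz^n\in\mathcal K[[z]]$, invertible under composition, with $h\circ f\circ h^{-1}(z)=\lambda z$. -/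

import Mathlib

namespace NonLin

noncomputable section

open PowerSeries

/-- A power series is locally analytic at `0` if it has positive radius of convergence:
`‖cₙ‖ ρⁿ → 0` for some `ρ > 0`. -/
def LocallyAnalytic {K : Type*} [NormedField K] (f : PowerSeries K) : Prop :=
  ∃ ρ : ℝ, 0 < ρ ∧ PowerSeries.IsRestricted ρ f

/-- `f` is locally linearizable at `0`: there is a locally analytic `h` with `h(0) = 0` which has a
compositional inverse `g = h⁻¹`, and `h ∘ f ∘ h⁻¹ (z) = λ z`, where `λ = f'(0)`.
(`PowerSeries.subst a b` is the composition `b ∘ a`.) -/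
def Linearizable {K : Type*} [NormedField K] (f : PowerSeries K) : Prop :=
  ∃ h g : PowerSeries K, LocallyAnalytic h ∧
    constantCoeff h = 0 ∧ constantCoeff g = 0 ∧
    subst g h = (X : PowerSeries K) ∧ subst h g = (X : PowerSeries K) ∧
    subst (subst g f : PowerSeries K) h = C (coeff 1 f) * (X : PowerSeries K)

/-- The coefficients `a₀ = λ, a₁, a₂, …` of `f(z) = z (λ + a₁ z + a₂ z² + ⋯)`. -/
def a {K : Type*} [NormedField K] (f : PowerSeries K) (i : ℕ) : K := coeff (i + 1) f

/-- The `μ`-adic valuation `log |x| / log |μ|`, where `μ = λ - 1`; its value at `0` is `∞`. -/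
def valMu {K : Type*} [NormedField K] (f : PowerSeries K) (x : K) : EReal :=
  open scoped Classical in
  if x = 0 then ⊤ else ((Real.log ‖x‖ / Real.log ‖a f 0 - 1‖ : ℝ) : EReal)

/-- The greatest common divisor of the `i ≥ 1` with `aᵢ ≠ 0` (it is `0` if there are none). -/
def u {K : Type*} [NormedField K] (f : PowerSeries K) : ℕ :=
  sSup {d : ℕ | ∀ i : ℕ, 1 ≤ i → a f i ≠ 0 → d ∣ i}

/-- The `p`-adic valuation of `u`. -/
def tau {K : Type*} [NormedField K] (p : ℕ) (f : PowerSeries K) : ℕ := padicValNat p (u f)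

/-- The multi-indices `α ∈ ℕ^(s-r+1)` with `∑ αᵢ = r + 1`, `∑ i αᵢ = s - r`, and `αᵢ = 0` whenever
`u ∤ i`. -/
def I {K : Type*} [NormedField K] (f : PowerSeries K) (r s : ℕ) : Finset (Fin (s - r + 1) → ℕ) :=
  open scoped Classical in
  ((Finset.univ : Finset (Fin (s - r + 1))).piAntidiag (r + 1)).filter fun α =>
    (∑ i : Fin (s - r + 1), (i : ℕ) * α i = s - r) ∧
      ∀ i : Fin (s - r + 1), ¬ u f ∣ (i : ℕ) → α i = 0

/-- `Φ(r, s) = (λ (1 - λˢ))⁻¹ ∑_{α ∈ I(r, s)} binom(r + 1; α) a^α`. -/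
def Phi {K : Type*} [NormedField K] (f : PowerSeries K) (r s : ℕ) : K :=
  1 / (a f 0 * (1 - a f 0 ^ s)) *
    ∑ α ∈ I f r s, (Nat.multinomial Finset.univ α : K) * ∏ i : Fin (s - r + 1), a f i ^ α i

/-- The sequences `r = β₀ < β₁ < ⋯ < βₜ = s` none of whose middle terms `β₁, …, βₜ₋₁` is
divisible by `p ^ k`. -/
def S (p k r s t : ℕ) : Finset (Fin (t + 1) → ℕ) :=
  open scoped Classical in
  (Fintype.piFinset fun _ : Fin (t + 1) => Finset.Icc r s).filter fun β =>
    StrictMono β ∧ β 0 = r ∧ β (Fin.last t) = s ∧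
      ∀ j : Fin (t + 1), j ≠ 0 → j ≠ Fin.last t → ¬ p ^ k ∣ β j

/-- `φ_k(r, s)`: the sum, over all increasing sequences `β` from `r` to `s` without middle terms
divisible by `p ^ k`, of the products `∏ⱼ Φ(u βⱼ, u βⱼ₊₁)`. -/
def phi {K : Type*} [NormedField K] (p : ℕ) (f : PowerSeries K) (k r s : ℕ) : K :=
  ∑ t ∈ Finset.Icc 1 (s - r), ∑ β ∈ S p k r s t,
    ∏ j : Fin t, Phi f (u f * β j.castSucc) (u f * β j.succ)

/-- `ψ_k(r, s) = φ_k(r, s) (1 - λ^(us)) / ((1 - λ^(p^(k+τ))) λ^(us-1))`. -/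
def psi {K : Type*} [NormedField K] (p : ℕ) (f : PowerSeries K) (k r s : ℕ) : K :=
  phi p f k r s *
    ((1 - a f 0 ^ (u f * s)) / ((1 - a f 0 ^ p ^ (k + tau p f)) * a f 0 ^ (u f * s - 1)))

/-- The slope `M_k(r, s) = val_μ(ψ_k(r, s)) / (s - r)`. -/
def slope {K : Type*} [NormedField K] (p : ℕ) (f : PowerSeries K) (k r s : ℕ) : EReal :=
  valMu f (psi p f k r s) / (((s : ℝ) - (r : ℝ) : ℝ) : EReal)

/-- `M_k`, the infimum of the slopes `M_k(r, s)` over the `p ^ k`-divisible integers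
`0 ≤ r < s`. -/
def M {K : Type*} [NormedField K] (p : ℕ) (f : PowerSeries K) (k : ℕ) : EReal :=
  sInf {m : EReal | ∃ r s : ℕ, p ^ k ∣ r ∧ p ^ k ∣ s ∧ r < s ∧ m = slope p f k r s}

/-- `f` is `k`-dominant:
`min_{1 ≤ d ≤ p-1} M_k(0, d p^k) ≤ min_{0 ≤ ℓ ≤ k-1} M_ℓ - p^(τ-1)`. -/
def Dominant {K : Type*} [NormedField K] (p : ℕ) (f : PowerSeries K) (k : ℕ) : Prop :=
  (⨅ d ∈ Finset.Icc 1 (p - 1), slope p f k 0 (d * p ^ k)) ≤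
    (⨅ l ∈ Finset.range k, M p f l) - (((p : ℝ) ^ ((tau p f : ℤ) - 1) : ℝ) : EReal)

end

end NonLin

/-! Write `Q = ‖1 - λ‖`. Comparing coefficients in `h ∘ f = λ h` gives `bₙ = ∑_{r<n} b_r Φ(r, n)`.
Hence `b_{us} / b₀` is the sum, over all increasing chains from `0` to `s`, of products of the `Φ(u
βⱼ, u βⱼ₊₁)`. A locally analytic `h` forces `‖b_{us} / b₀‖ ≤ Q ^ (T s)` for some real `T`, so it
suffices to find levels whose least slope tends to `-∞`.

Grouping chains by their last vertex divisible by `p ^ l` expresses `φ_{l+1}` through `φ_l`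
(`phi_succ`). After normalization (`chi_rec`) the vertex factors `κ` have norm one, so slope bounds
pass through the recursion. Raising the level then multiplies by a factor of norm `Q ^ (p^(l+τ) -
p^(l+1+τ)) > 1`, which is where small divisors enter.

Suppose level `k` is dominant: the least slope `m'` over the short edges `(0, d p^k)`, `d < p`, is
at most `m - p^(τ-1)`, where `m` bounds all lower slopes. Two facts simplify `ψ_k`. Edges of length
at least `p^(k+1)` are negligible against slope `m'` (`RealDominant.norm_psi_lt`). Up to negligible
terms `ψ_k(r, s)` depends only on `s - r`, because Frobenius makes shifts by multiples of `p^k`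
nearly invisible (`Admissible.psi_shift_le`).

Moreover `κ_k(p^k n) ≡ 1 / (v n)`, where `v` is the prime-to-`p` part of `u`. So if all `χ_k(0, d
p^(k+1))`, `1 ≤ d < p`, were small, the vertex weights `yₙ` would satisfy `x y' = W y` approximately
modulo `x^(p²)`, with `W` of degree below `p`. This is impossible: `D = x d/dx` satisfies `D^p = D`,
while iterating the equation gives `D^p y = P y` with `P` of leading coefficient `w_e^p` in degree
`p e < p²` (`not_approx_euler_eq`).

Hence some `χ_k(0, d p^(k+1))` has slope at most `m'`, and renormalizing makes level `k + 1`
dominant with slope lower by at least `p^(τ-1)` (`RealDominant.succ`). Iteration sends the slopes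
below every `T`, contradicting the growth bound (`RealDominant.not_bounded`). -/

namespace NonLin

/-! ### Sums over increasing chains of integers -/

section Chains

theorem add_le_of_strictMono {t : ℕ} {β : Fin (t + 1) → ℕ} (hβ : StrictMono β)
    (i : Fin (t + 1)) : β 0 + i ≤ β i := by
  induction i using Fin.induction with
  | zero => simp
  | succ i ih =>
    have := hβ (Fin.castSucc_lt_succ (i := i))
    simp only [Fin.val_castSucc, Fin.val_succ] at *
    omega

theorem mem_S {p k r s t : ℕ} {β : Fin (t + 1) → ℕ} :
    β ∈ S p k r s t ↔ StrictMono β ∧ β 0 = r ∧ β (Fin.last t) = s ∧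
      ∀ j : Fin (t + 1), j ≠ 0 → j ≠ Fin.last t → ¬ p ^ k ∣ β j := by
  simp only [S, Finset.mem_filter, Fintype.mem_piFinset, Finset.mem_Icc, and_iff_right_iff_imp]
  rintro ⟨h, rfl, rfl, -⟩ j
  exact ⟨h.monotone (Fin.zero_le j), h.monotone (Fin.le_last j)⟩

theorem S_eq_empty {p k r s t : ℕ} (h : s - r < t) : S p k r s t = ∅ := by
  refine Finset.eq_empty_of_forall_notMem fun β hβ => ?_
  obtain ⟨hm, h0, hl, -⟩ := mem_S.1 hβ
  have := add_le_of_strictMono hm (Fin.last t)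
  rw [h0, hl, Fin.val_last] at this
  omega

variable {R : Type*} [CommRing R]

theorem sum_S_one (p k : ℕ) {r s : ℕ} (h : r < s) (w : ℕ → ℕ → R) :
    ∑ β ∈ S p k r s 1, ∏ j : Fin 1, w (β j.castSucc) (β j.succ) = w r s := by
  have : S p k r s 1 = {![r, s]} := by
    ext β
    rw [mem_S, Finset.mem_singleton]
    constructor
    · rintro ⟨-, h0, h1, -⟩
      ext j
      fin_cases j
      · exact h0
      · exact h1
    · rintro rfl
      refine ⟨?_, rfl, rfl, fun j h0 h1 => ?_⟩
      · intro i j hij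
        fin_cases i <;> fin_cases j <;> simp_all
      · fin_cases j <;> simp_all
  rw [this]
  simp

/-- Cut off the last vertex. The penultimate vertex `x` is a middle vertex because `1 ≤ t`, hence is
not divisible by `p ^ k`. -/
theorem sum_S_succ (p k r s : ℕ) {t : ℕ} (ht : 1 ≤ t) (w : ℕ → ℕ → R) :
    ∑ β ∈ S p k r s (t + 1), ∏ j : Fin (t + 1), w (β j.castSucc) (β j.succ) =
      ∑ x ∈ Finset.Ioo r s with ¬ p ^ k ∣ x,
        (∑ β ∈ S p k r x t, ∏ j : Fin t, w (β j.castSucc) (β j.succ)) * w x s := by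
  simp_rw [Finset.sum_mul]
  rw [Finset.sum_sigma']
  refine Finset.sum_bij' (fun β _ => ⟨β (Fin.last t).castSucc, fun i => β i.castSucc⟩)
    (fun γ _ => Fin.snoc γ.2 s) ?_ ?_ ?_ ?_ ?_
  · intro β hβ
    obtain ⟨hm, h0, hl, hd⟩ := mem_S.1 hβ
    simp only [Finset.mem_sigma, Finset.mem_filter, Finset.mem_Ioo, mem_S]
    refine ⟨⟨⟨?_, ?_⟩, ?_⟩, ?_, ?_, trivial, ?_⟩
    · rw [← h0]
      apply hm
      rw [Fin.lt_def]
      simp only [Fin.val_castSucc, Fin.val_last, Fin.val_zero]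
      omega
    · rw [← hl]
      exact hm (Fin.castSucc_lt_last _)
    · apply hd
      · intro h
        have := congrArg Fin.val h
        simp at this
        omega
      · exact (Fin.castSucc_lt_last _).ne
    · exact fun i j hij => hm (Fin.castSucc_lt_castSucc_iff.2 hij)
    · exact h0
    · intro j hj hj'
      apply hd
      · rwa [Ne, Fin.castSucc_eq_zero_iff]
      · exact (Fin.castSucc_lt_last _).ne
  · rintro ⟨x, γ⟩ hγ
    simp only [Finset.mem_sigma, Finset.mem_filter, Finset.mem_Ioo, mem_S] at hγ
    obtain ⟨⟨⟨h1, h2⟩, h3⟩, hm, h0, hl, hd⟩ := hγ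
    rw [mem_S]
    refine ⟨?_, ?_, by simp, ?_⟩
    · rw [Fin.strictMono_iff_lt_succ]
      intro i
      induction i using Fin.lastCases with
      | last =>
        rw [Fin.succ_last, Fin.snoc_last, Fin.snoc_castSucc]
        simpa [hl] using h2
      | cast i =>
        rw [Fin.succ_castSucc, Fin.snoc_castSucc, Fin.snoc_castSucc]
        exact hm (Fin.castSucc_lt_succ)
    · rw [← Fin.castSucc_zero, Fin.snoc_castSucc]
      exact h0
    · intro j hj hj'
      induction j using Fin.lastCases with
      | last => exact absurd rfl hj'
      | cast i =>
        rw [Fin.snoc_castSucc]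
        by_cases hi : i = Fin.last t
        · subst hi
          simpa [hl] using h3
        · exact hd i (by rwa [Ne, Fin.castSucc_eq_zero_iff] at hj) hi
  · intro β hβ
    obtain ⟨hm, h0, hl, hd⟩ := mem_S.1 hβ
    simp only [← hl]
    exact Fin.snoc_init_self β
  · rintro ⟨x, γ⟩ hγ
    simp only [Finset.mem_sigma, Finset.mem_filter, Finset.mem_Ioo, mem_S] at hγ
    obtain ⟨⟨⟨h1, h2⟩, h3⟩, hm, h0, hl, hd⟩ := hγ
    subst hl
    simp
  · intro β hβ
    obtain ⟨hm, h0, hl, hd⟩ := mem_S.1 hβ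
    rw [Fin.prod_univ_castSucc]
    congr 1
    rw [Fin.succ_last, hl]

theorem sum_chains_rec (p k : ℕ) {r s : ℕ} (h : r < s) (w : ℕ → ℕ → R) :
    ∑ t ∈ Finset.Icc 1 (s - r), ∑ β ∈ S p k r s t, ∏ j : Fin t, w (β j.castSucc) (β j.succ) =
      w r s + ∑ x ∈ Finset.Ioo r s with ¬ p ^ k ∣ x,
        (∑ t ∈ Finset.Icc 1 (x - r), ∑ β ∈ S p k r x t,
          ∏ j : Fin t, w (β j.castSucc) (β j.succ)) * w x s := by
  obtain ⟨n, hn⟩ : ∃ n, s - r = n + 1 := ⟨s - r - 1, by omega⟩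
  have hicc : Finset.Icc 1 (n + 1) = insert 1 ((Finset.Icc 1 n).map (addRightEmbedding 1)) := by
    ext x
    simp only [Finset.mem_Icc, Finset.mem_insert, Finset.mem_map, addRightEmbedding_apply]
    constructor
    · intro hx
      by_cases h1 : x = 1
      · exact Or.inl h1
      · exact Or.inr ⟨x - 1, by omega, by omega⟩
    · rintro (rfl | ⟨y, hy, rfl⟩) <;> omega
  rw [hn, hicc, Finset.sum_insert (by simp), sum_S_one p k h, Finset.sum_map]
  congr 1
  refine (Finset.sum_congr rfl fun t ht =>
    sum_S_succ p k r s (Finset.mem_Icc.1 ht).1 w).trans ?_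
  rw [Finset.sum_comm]
  refine Finset.sum_congr rfl fun x hx => ?_
  rw [← Finset.sum_mul]
  congr 1
  simp only [Finset.mem_filter, Finset.mem_Ioo] at hx
  symm
  refine Finset.sum_subset (Finset.Icc_subset_Icc le_rfl (by omega)) fun t ht ht' => ?_
  rw [S_eq_empty, Finset.sum_empty]
  simp only [Finset.mem_Icc] at ht ht'
  omega

/-- Two solutions of the last-step recursion with nested sets of allowed middle terms. -/
theorem rec_refine {w φ : ℕ → ℕ → R} {φ' : ℕ → R} {P P' : ℕ → Prop} [DecidablePred P] [DecidablePred P']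
    (hPP : ∀ x, P' x → P x)
    (hφ : ∀ r s, r < s → φ r s = w r s + ∑ x ∈ Finset.Ioo r s with ¬ P x, φ r x * w x s)
    {r : ℕ}
    (hφ' : ∀ s, r < s → φ' s = w r s + ∑ x ∈ Finset.Ioo r s with ¬ P' x, φ' x * w x s)
    (s : ℕ) (h : r < s) :
    φ' s = φ r s + ∑ x ∈ Finset.Ioo r s with P x ∧ ¬ P' x, φ' x * φ x s := by
  induction s using Nat.strong_induction_on with
  | _ s ih =>
  have hsplit : ∑ x ∈ Finset.Ioo r s with ¬ P' x, φ' x * w x s =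
      ∑ x ∈ Finset.Ioo r s with P x ∧ ¬ P' x, φ' x * w x s +
        ∑ x ∈ Finset.Ioo r s with ¬ P x, φ' x * w x s := by
    rw [← Finset.sum_filter_add_sum_filter_not _ (fun x => P x), Finset.filter_filter,
      Finset.filter_filter]
    congr 1 <;> refine Finset.sum_congr (Finset.filter_congr fun x _ => ?_) fun _ _ => rfl
    · tauto
    · exact ⟨fun hx => hx.2, fun hx => ⟨fun h' => hx (hPP x h'), hx⟩⟩
  have h1 : ∑ x ∈ Finset.Ioo r s with ¬ P x, φ' x * w x s =
      ∑ x ∈ Finset.Ioo r s with ¬ P x, φ r x * w x s +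
        ∑ x ∈ Finset.Ioo r s with ¬ P x,
          ∑ y ∈ Finset.Ioo r x with P y ∧ ¬ P' y, φ' y * φ y x * w x s := by
    rw [← Finset.sum_add_distrib]
    refine Finset.sum_congr rfl fun x hx => ?_
    simp only [Finset.mem_filter, Finset.mem_Ioo] at hx
    rw [ih x hx.1.2 hx.1.1, add_mul, Finset.sum_mul]
  have h2 : ∑ x ∈ Finset.Ioo r s with P x ∧ ¬ P' x, φ' x * φ x s =
      ∑ x ∈ Finset.Ioo r s with P x ∧ ¬ P' x, φ' x * w x s +
        ∑ y ∈ Finset.Ioo r s with P y ∧ ¬ P' y,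
          ∑ x ∈ Finset.Ioo y s with ¬ P x, φ' y * φ y x * w x s := by
    rw [← Finset.sum_add_distrib]
    refine Finset.sum_congr rfl fun x hx => ?_
    simp only [Finset.mem_filter, Finset.mem_Ioo] at hx
    rw [hφ x s hx.1.2, mul_add, Finset.mul_sum]
    simp_rw [mul_assoc]
  -- Both double sums run over the same pairs `y < x`, with `y` the last vertex in `P` outside `P'`
  -- and `x` the penultimate vertex.
  have h3 : ∑ x ∈ Finset.Ioo r s with ¬ P x,
          ∑ y ∈ Finset.Ioo r x with P y ∧ ¬ P' y, φ' y * φ y x * w x s =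
      ∑ y ∈ Finset.Ioo r s with P y ∧ ¬ P' y,
          ∑ x ∈ Finset.Ioo y s with ¬ P x, φ' y * φ y x * w x s := by
    refine Finset.sum_comm' fun x y => ?_
    simp only [Finset.mem_filter, Finset.mem_Ioo]
    constructor
    · rintro ⟨⟨⟨h1, h2⟩, h3⟩, ⟨h4, h5⟩, h6⟩
      exact ⟨⟨⟨h5, h2⟩, h3⟩, ⟨h4, by omega⟩, h6⟩
    · rintro ⟨⟨⟨h1, h2⟩, h3⟩, ⟨h4, h5⟩, h6⟩
      exact ⟨⟨⟨by omega, h2⟩, h3⟩, ⟨h4, h1⟩, h6⟩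
  rw [hφ' s h, hφ r s h, hsplit, h1, h2, h3]
  ring

end Chains

/-! ### Recursions for `φ_k`, and `Φ` as a power series coefficient -/

section Phi

open PowerSeries

variable {K : Type*} [NormedField K]

theorem phi_rec (p : ℕ) (f : PowerSeries K) (k r s : ℕ) (h : r < s) :
    phi p f k r s = Phi f (u f * r) (u f * s) +
      ∑ x ∈ Finset.Ioo r s with ¬ p ^ k ∣ x, phi p f k r x * Phi f (u f * x) (u f * s) :=
  sum_chains_rec p k h fun x y => Phi f (u f * x) (u f * y)

/-- Cut each chain at its last middle vertex divisible by `p ^ k`, if there is one. -/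
theorem phi_succ (p : ℕ) (f : PowerSeries K) (k r s : ℕ) (h : r < s) :
    phi p f (k + 1) r s = phi p f k r s +
      ∑ x ∈ Finset.Ioo r s with p ^ k ∣ x ∧ ¬ p ^ (k + 1) ∣ x,
        phi p f (k + 1) r x * phi p f k x s :=
  rec_refine (fun _ hx => (pow_dvd_pow p k.le_succ).trans hx) (phi_rec p f k)
    (phi_rec p f (k + 1) r) s h

theorem phi_zero (p : ℕ) (f : PowerSeries K) (r s : ℕ) (h : r < s) :
    phi p f 0 r s = Phi f (u f * r) (u f * s) := by
  rw [phi_rec p f 0 r s h]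
  simp

theorem u_mem {f : PowerSeries K} (hf : ∃ i, 1 ≤ i ∧ a f i ≠ 0) :
    (∀ i, 1 ≤ i → a f i ≠ 0 → u f ∣ i) := by
  obtain ⟨i, hi, hai⟩ := hf
  exact Nat.sSup_mem (s := {d : ℕ | ∀ i : ℕ, 1 ≤ i → a f i ≠ 0 → d ∣ i}) ⟨1, fun i _ _ => one_dvd i⟩
    ⟨i, fun d hd => Nat.le_of_dvd hi (hd i hi hai)⟩

theorem u_pos {f : PowerSeries K} (hf : ∃ i, 1 ≤ i ∧ a f i ≠ 0) : 0 < u f := by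
  obtain ⟨i, hi, hai⟩ := hf
  exact Nat.pos_of_dvd_of_pos (u_mem ⟨i, hi, hai⟩ i hi hai) hi

theorem coeff_mk_pow (c : ℕ → K) (N n : ℕ) :
    coeff N (mk c ^ n) = ∑ α ∈ (Finset.univ : Finset (Fin (N + 1))).piAntidiag n with
      ∑ i : Fin (N + 1), (i : ℕ) * α i = N,
        (Nat.multinomial Finset.univ α : K) * ∏ i : Fin (N + 1), c i ^ α i := by
  have htr : ((trunc (N + 1) (mk c) : Polynomial K) : PowerSeries K) =
      ∑ i : Fin (N + 1), C (c i) * X ^ (i : ℕ) := by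
    ext j
    rw [Polynomial.coeff_coe, coeff_trunc, map_sum]
    simp only [coeff_C_mul, coeff_X_pow, coeff_mk, mul_ite, mul_one, mul_zero]
    split_ifs with hj
    · rw [Finset.sum_eq_single (⟨j, hj⟩ : Fin (N + 1))]
      · simp
      · intro b _ hb
        rw [if_neg]
        rintro rfl
        exact hb rfl
      · simp
    · refine (Finset.sum_eq_zero fun b _ => ?_).symm
      rw [if_neg]
      rintro rfl
      exact hj b.2
  rw [← coeff_coe_trunc_of_lt (Nat.lt_succ_self N), ← trunc_trunc_pow,
    coeff_coe_trunc_of_lt (Nat.lt_succ_self N), htr, Finset.sum_pow_eq_sum_piAntidiag, map_sum,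
    Finset.sum_filter]
  refine Finset.sum_congr rfl fun α _ => ?_
  have : ∏ i : Fin (N + 1), (C (c i) * X ^ (i : ℕ) : PowerSeries K) ^ α i =
      C (∏ i : Fin (N + 1), c i ^ α i) * X ^ (∑ i : Fin (N + 1), (i : ℕ) * α i) := by
    rw [map_prod, ← Finset.prod_pow_eq_pow_sum, ← Finset.prod_mul_distrib]
    refine Finset.prod_congr rfl fun i _ => ?_
    rw [mul_pow, map_pow, pow_mul]
  rw [this, ← map_natCast (C (R := K)), ← mul_assoc, ← map_mul, coeff_C_mul, coeff_X_pow]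
  simp [eq_comm]

/-- The condition involving `u` in `I` discards only zero terms: a multi-index violating it has a
factor `aᵢ = 0` with positive exponent. -/
theorem Phi_eq {f : PowerSeries K} (hf : ∃ i, 1 ≤ i ∧ a f i ≠ 0) (r s : ℕ) :
    Phi f r s = 1 / (a f 0 * (1 - a f 0 ^ s)) * coeff (s - r) (mk (a f) ^ (r + 1)) := by
  classical
  rw [Phi, coeff_mk_pow]
  congr 1
  refine Finset.sum_subset (fun α hα => ?_) fun α hα hα' => ?_
  · simp only [I, Finset.mem_filter] at hα ⊢
    exact ⟨hα.1, hα.2.1⟩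
  · simp only [I, Finset.mem_filter, not_and, not_forall] at hα hα'
    obtain ⟨i, hi, hi'⟩ := hα' hα.1 hα.2
    refine mul_eq_zero_of_right _ (Finset.prod_eq_zero (Finset.mem_univ i) ?_)
    rw [pow_eq_zero_iff hi']
    by_contra hai
    refine hi (u_mem hf i ?_ hai)
    by_contra h0
    apply hi
    rw [show (i : ℕ) = 0 by omega]
    exact dvd_zero _

end Phi

/-! ### Ultrametric norms in characteristic `p` -/

section Norms

variable {K : Type*} [NormedField K]

/-- Nonzero elements of the prime field are roots of unity. -/
theorem norm_natCast_eq_one (p : ℕ) [Fact p.Prime] [CharP K p] {n : ℕ} (hn : ¬ p ∣ n) :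
    ‖(n : K)‖ = 1 := by
  have h : (n : ZMod p) ≠ 0 := by rwa [Ne, ZMod.natCast_eq_zero_iff]
  have h1 := congrArg (ZMod.castHom (dvd_refl p) K) (ZMod.pow_card_sub_one_eq_one h)
  rw [map_pow, map_natCast, map_one] at h1
  have h2 := congrArg norm h1
  rw [norm_pow, norm_one] at h2
  exact (pow_eq_one_iff_of_nonneg (norm_nonneg _)
    (Nat.sub_ne_zero_of_lt (Fact.out : p.Prime).one_lt)).1 h2

theorem natCast_pow_char (p : ℕ) [Fact p.Prime] [CharP K p] (n : ℕ) : (n : K) ^ p = n := by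
  have h1 := congrArg (ZMod.castHom (dvd_refl p) K) (ZMod.pow_card (n : ZMod p))
  rwa [map_pow, map_natCast] at h1

theorem natCast_pow_char_pow (p : ℕ) [Fact p.Prime] [CharP K p] (n N : ℕ) :
    (n : K) ^ p ^ N = n := by
  induction N with
  | zero => simp
  | succ N ih => rw [pow_succ, pow_mul, ih, natCast_pow_char]

theorem rpow_natCast_pow (x : ℝ) (p N : ℕ) : x ^ ((p : ℝ) ^ N) = x ^ p ^ N := by
  rw [← Nat.cast_pow, Real.rpow_natCast]

theorem one_sub_pow_mul_char_pow {p : ℕ} [Fact p.Prime] [CharP K p] (x : K) (N n : ℕ) :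
    1 - x ^ (p ^ N * n) = (1 - x ^ n) ^ p ^ N := by
  rw [sub_pow_char_pow, one_pow, ← pow_mul, mul_comm]

variable [IsUltrametricDist K]

theorem norm_one_of_norm_sub_one_lt {x : K} (h : ‖1 - x‖ < 1) : ‖x‖ = 1 := by
  have := IsUltrametricDist.norm_eq_of_add_norm_lt_max (x := x) (y := -1)
    (by
      rw [norm_neg, norm_one, ← sub_eq_add_neg, norm_sub_rev]
      exact h.trans_le (le_max_right _ _))
  rwa [norm_neg, norm_one] at this

theorem norm_add_lt {x y : K} {c : ℝ} (hx : ‖x‖ < c) (hy : ‖y‖ < c) : ‖x + y‖ < c :=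
  (IsUltrametricDist.norm_add_le_max x y).trans_lt (max_lt hx hy)

theorem norm_add_le' {x y : K} {c : ℝ} (hx : ‖x‖ ≤ c) (hy : ‖y‖ ≤ c) : ‖x + y‖ ≤ c :=
  (IsUltrametricDist.norm_add_le_max x y).trans (max_le hx hy)

theorem norm_sub_lt {x y : K} {c : ℝ} (hx : ‖x‖ < c) (hy : ‖y‖ < c) : ‖x - y‖ < c := by
  rw [sub_eq_add_neg]
  exact norm_add_lt hx (by rwa [norm_neg])

theorem norm_sub_le' {x y : K} {c : ℝ} (hx : ‖x‖ ≤ c) (hy : ‖y‖ ≤ c) : ‖x - y‖ ≤ c := by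
  rw [sub_eq_add_neg]
  exact norm_add_le' hx (by rwa [norm_neg])

theorem norm_sum_lt {ι : Type*} {s : Finset ι} {g : ι → K} {c : ℝ} (hc : 0 < c)
    (h : ∀ i ∈ s, ‖g i‖ < c) : ‖∑ i ∈ s, g i‖ < c := by
  rcases s.eq_empty_or_nonempty with rfl | hs
  · simpa
  · obtain ⟨i, hi, hle⟩ := IsUltrametricDist.exists_norm_finsetSum_le_of_nonempty hs g
    exact hle.trans_lt (h i hi)

theorem norm_one_sub_pow_lt {x : K} (h : ‖1 - x‖ < 1) (n : ℕ) : ‖1 - x ^ n‖ < 1 := by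
  have h1 := norm_one_of_norm_sub_one_lt h
  rw [← norm_neg, neg_sub, ← geom_sum_mul, norm_mul]
  rw [← norm_neg, neg_sub] at h
  refine (mul_le_of_le_one_left (norm_nonneg _) ?_).trans_lt h
  exact IsUltrametricDist.norm_sum_le_of_forall_le_of_nonneg zero_le_one fun i _ => by
    rw [norm_pow, h1, one_pow]

theorem norm_geom_sum_sub_lt {x : K} (h : ‖1 - x‖ < 1) (n : ℕ) :
    ‖∑ j ∈ Finset.range n, x ^ j - (n : K)‖ < 1 := by
  have : ∑ j ∈ Finset.range n, x ^ j - (n : K) = ∑ j ∈ Finset.range n, (x ^ j - 1) := by simp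
  rw [this]
  refine norm_sum_lt one_pos fun j _ => ?_
  rw [norm_sub_rev]
  exact norm_one_sub_pow_lt h j

theorem norm_eq_one_of_norm_sub_lt {x y : K} (hy : ‖y‖ = 1) (h : ‖x - y‖ < 1) : ‖x‖ = 1 := by
  have := IsUltrametricDist.norm_eq_of_add_norm_lt_max (x := x) (y := -y)
    (by
      rw [norm_neg, hy, ← sub_eq_add_neg]
      exact h.trans_le (le_max_right _ _))
  rwa [norm_neg, hy] at this

end Norms

/-! ### The normalized recursion and its vertex factors `κ` -/

section Setting

variable {K : Type*} [NormedField K]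

/-- The multiplier `a₀` is a non-root of unity in the residue disc of `1`, and some `aᵢ ≠ 0`. -/
structure Admissible (f : PowerSeries K) : Prop where
  exists_ne : ∃ i, 1 ≤ i ∧ a f i ≠ 0
  pow_ne : ∀ n : ℕ, 1 ≤ n → a f 0 ^ n ≠ 1
  norm_lt : ‖1 - a f 0‖ < 1

theorem Admissible.u_pos {f : PowerSeries K} (hf : Admissible f) : 0 < u f :=
  NonLin.u_pos hf.exists_ne

theorem Admissible.q_pos {f : PowerSeries K} (hf : Admissible f) : 0 < ‖1 - a f 0‖ := by
  rw [norm_pos_iff, sub_ne_zero]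
  simpa using (hf.pow_ne 1 le_rfl).symm

theorem Admissible.one_sub_ne {f : PowerSeries K} (hf : Admissible f) {n : ℕ} (hn : 0 < n) :
    1 - a f 0 ^ n ≠ 0 := sub_ne_zero.2 (hf.pow_ne n hn).symm

theorem Admissible.u_eq (p : ℕ) [Fact p.Prime] {f : PowerSeries K} (hf : Admissible f) :
    ∃ v : ℕ, u f = p ^ tau p f * v ∧ ¬ p ∣ v := by
  obtain ⟨v, hv⟩ := pow_padicValNat_dvd (p := p) (n := u f)
  refine ⟨v, hv, ?_⟩
  rintro ⟨w, rfl⟩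
  refine pow_succ_padicValNat_not_dvd (p := p) hf.u_pos.ne' ⟨w, ?_⟩
  rw [pow_succ, mul_assoc]
  exact hv

/-- The factor relating `phi` and `psi`. -/
noncomputable def kappa (p : ℕ) (f : PowerSeries K) (l x : ℕ) : K :=
  (1 - a f 0 ^ p ^ (l + tau p f)) * a f 0 ^ (u f * x - 1) / (1 - a f 0 ^ (u f * x))

/-- `phi` at level `l + 1`, normalized at level `l`. -/
noncomputable def chi (p : ℕ) (f : PowerSeries K) (l r s : ℕ) : K :=
  phi p f (l + 1) r s / kappa p f l s

variable [IsUltrametricDist K]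

theorem Admissible.norm_lam {f : PowerSeries K} (hf : Admissible f) : ‖a f 0‖ = 1 :=
  norm_one_of_norm_sub_one_lt hf.norm_lt

theorem Admissible.lam_ne {f : PowerSeries K} (hf : Admissible f) : a f 0 ≠ 0 := by
  rw [← norm_ne_zero_iff, hf.norm_lam]
  exact one_ne_zero

theorem Admissible.norm_one_sub_le {f : PowerSeries K} (hf : Admissible f) (n : ℕ) :
    ‖1 - a f 0 ^ n‖ ≤ ‖1 - a f 0‖ := by
  rw [← norm_neg, neg_sub, ← geom_sum_mul, norm_mul, norm_sub_rev]
  refine mul_le_of_le_one_left (norm_nonneg _) ?_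
  exact IsUltrametricDist.norm_sum_le_of_forall_le_of_nonneg zero_le_one fun i _ => by
    rw [norm_pow, hf.norm_lam, one_pow]

variable {p : ℕ} [Fact p.Prime]

theorem Admissible.kappa_ne {f : PowerSeries K} (hf : Admissible f) (l : ℕ) {x : ℕ} (hx : 0 < x) :
    kappa p f l x ≠ 0 :=
  div_ne_zero (mul_ne_zero (hf.one_sub_ne (pow_pos (Fact.out : p.Prime).pos _))
    (pow_ne_zero _ hf.lam_ne)) (hf.one_sub_ne (mul_pos hf.u_pos hx))

theorem Admissible.phi_eq {f : PowerSeries K} (hf : Admissible f) (l r : ℕ) {s : ℕ} (hs : 0 < s) :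
    phi p f l r s = psi p f l r s * kappa p f l s := by
  have h1 := hf.one_sub_ne (mul_pos hf.u_pos hs)
  have h2 := hf.one_sub_ne (pow_pos (Fact.out : p.Prime).pos (l + tau p f))
  have h3 := pow_ne_zero (u f * s - 1) hf.lam_ne
  rw [psi, kappa]
  field_simp

theorem Admissible.chi_mul_kappa {f : PowerSeries K} (hf : Admissible f) (l r : ℕ) {s : ℕ}
    (hs : 0 < s) : chi p f l r s * kappa p f l s = phi p f (l + 1) r s :=
  div_mul_cancel₀ _ (hf.kappa_ne l hs)

theorem Admissible.psi_succ {f : PowerSeries K} (hf : Admissible f) (l r : ℕ) {s : ℕ}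
    (hs : 0 < s) : psi p f (l + 1) r s =
      chi p f l r s * ((1 - a f 0 ^ p ^ (l + tau p f)) / (1 - a f 0 ^ p ^ (l + 1 + tau p f))) := by
  have h1 := hf.one_sub_ne (mul_pos hf.u_pos hs)
  have h2 := hf.one_sub_ne (pow_pos (Fact.out : p.Prime).pos (l + tau p f))
  have h2' := hf.one_sub_ne (pow_pos (Fact.out : p.Prime).pos (l + 1 + tau p f))
  have h3 := pow_ne_zero (u f * s - 1) hf.lam_ne
  rw [psi, ← hf.chi_mul_kappa l r hs, kappa]
  field_simp

/-- This is `phi_succ` divided by `κ_l(s)`. All divisors are now collected in the `κ_l(x)`, which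
have norm one at the vertices that occur. -/
theorem Admissible.chi_rec {f : PowerSeries K} (hf : Admissible f) (l : ℕ) {r s : ℕ} (h : r < s) :
    chi p f l r s = psi p f l r s +
      ∑ x ∈ Finset.Ioo r s with p ^ l ∣ x ∧ ¬ p ^ (l + 1) ∣ x,
        chi p f l r x * kappa p f l x * psi p f l x s := by
  have hs : 0 < s := by omega
  have hk := hf.kappa_ne (p := p) l hs
  rw [chi, div_eq_iff hk, phi_succ p f l r s h, add_mul, ← hf.phi_eq l r hs, Finset.sum_mul]
  congr 1
  refine Finset.sum_congr rfl fun x hx => ?_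
  simp only [Finset.mem_filter, Finset.mem_Ioo] at hx
  rw [hf.chi_mul_kappa l r (by omega), hf.phi_eq l x hs, mul_assoc]

variable [CharP K p]

theorem Admissible.norm_one_sub_pow_le (p : ℕ) [Fact p.Prime] [CharP K p] {f : PowerSeries K}
    (hf : Admissible f) (N n : ℕ) :
    ‖1 - a f 0 ^ (p ^ N * n)‖ ≤ ‖1 - a f 0‖ ^ p ^ N := by
  rw [one_sub_pow_mul_char_pow, norm_pow]
  exact pow_le_pow_left₀ (norm_nonneg _) (hf.norm_one_sub_le n) _

theorem Admissible.norm_one_sub_pow_eq {f : PowerSeries K}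
    (hf : Admissible f) (N : ℕ) {n : ℕ} (hn : ¬ p ∣ n) :
    ‖1 - a f 0 ^ (p ^ N * n)‖ = ‖1 - a f 0‖ ^ p ^ N := by
  rw [one_sub_pow_mul_char_pow, norm_pow]
  congr 1
  rw [← norm_neg, neg_sub, ← geom_sum_mul, norm_mul, norm_sub_rev,
    norm_eq_one_of_norm_sub_lt (norm_natCast_eq_one p hn) (norm_geom_sum_sub_lt hf.norm_lt n),
    one_mul]

theorem Admissible.norm_one_sub_char_pow (p : ℕ) [Fact p.Prime] [CharP K p] {f : PowerSeries K}
    (hf : Admissible f) (N : ℕ) :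
    ‖1 - a f 0 ^ p ^ N‖ = ‖1 - a f 0‖ ^ p ^ N := by
  simpa using hf.norm_one_sub_pow_eq (p := p) N (n := 1) (Fact.out : p.Prime).not_dvd_one

theorem Admissible.norm_one_sub_u {f : PowerSeries K} (hf : Admissible f) {l x : ℕ}
    (hx : p ^ l ∣ x) (hx' : ¬ p ^ (l + 1) ∣ x) :
    ‖1 - a f 0 ^ (u f * x)‖ = ‖1 - a f 0‖ ^ p ^ (l + tau p f) := by
  obtain ⟨v, hv, hpv⟩ := hf.u_eq p
  obtain ⟨n, rfl⟩ := hx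
  rw [pow_succ, Nat.mul_dvd_mul_iff_left (pow_pos (Fact.out : p.Prime).pos _)] at hx'
  rw [hv, show p ^ tau p f * v * (p ^ l * n) = p ^ (l + tau p f) * (v * n) by ring,
    hf.norm_one_sub_pow_eq]
  rw [(Fact.out : p.Prime).dvd_mul]
  tauto

theorem Admissible.norm_kappa {f : PowerSeries K} (hf : Admissible f) {l x : ℕ}
    (hx : p ^ l ∣ x) (hx' : ¬ p ^ (l + 1) ∣ x) : ‖kappa p f l x‖ = 1 := by
  rw [kappa, norm_div, norm_mul, norm_pow, hf.norm_lam, one_pow, mul_one,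
    hf.norm_one_sub_char_pow p, hf.norm_one_sub_u hx hx', div_self]
  exact pow_ne_zero _ hf.q_pos.ne'

/-- The denominator of `κ` is `((1 - λ) G) ^ p^(l+τ)` with `G = ∑_{j < vn} λ^j ≡ v n`, and Frobenius
fixes `v n`. This congruence is what produces the derivative in the Euler equation. -/
theorem Admissible.norm_kappa_mul_sub_lt {f : PowerSeries K} (hf : Admissible f) {v : ℕ}
    (hv : u f = p ^ tau p f * v) (hpv : ¬ p ∣ v) (l : ℕ) {n : ℕ} (hn : ¬ p ∣ n) :
    ‖((v * n : ℕ) : K) * kappa p f l (p ^ l * n) - 1‖ < 1 := by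
  have hvn : ¬ p ∣ v * n := by
    rw [(Fact.out : p.Prime).dvd_mul]
    tauto
  set G := ∑ j ∈ Finset.range (v * n), a f 0 ^ j with hG
  have hG1 := norm_geom_sum_sub_lt hf.norm_lt (v * n)
  rw [← hG] at hG1
  have hGn : ‖G‖ = 1 := norm_eq_one_of_norm_sub_lt (norm_natCast_eq_one p hvn) hG1
  have hG0 : G ≠ 0 := by
    rw [← norm_ne_zero_iff, hGn]
    exact one_ne_zero
  have hexp : u f * (p ^ l * n) = p ^ (l + tau p f) * (v * n) := by rw [hv]; ring
  have hden : 1 - a f 0 ^ (u f * (p ^ l * n)) =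
      (1 - a f 0) ^ p ^ (l + tau p f) * G ^ p ^ (l + tau p f) := by
    rw [hexp, one_sub_pow_mul_char_pow, ← mul_pow, hG, mul_neg_geom_sum]
  have hnum : 1 - a f 0 ^ p ^ (l + tau p f) = (1 - a f 0) ^ p ^ (l + tau p f) := by
    simpa using one_sub_pow_mul_char_pow (p := p) (a f 0) (l + tau p f) 1
  have h1 : (1 - a f 0) ^ p ^ (l + tau p f) ≠ 0 :=
    pow_ne_zero _ (norm_pos_iff.1 hf.q_pos)
  have hk : kappa p f l (p ^ l * n) =
      a f 0 ^ (u f * (p ^ l * n) - 1) / G ^ p ^ (l + tau p f) := by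
    rw [kappa, hden, hnum, mul_div_mul_left _ _ h1]
  set e := u f * (p ^ l * n) - 1
  have : ((v * n : ℕ) : K) * kappa p f l (p ^ l * n) - 1 =
      (((v * n : ℕ) : K) * (a f 0 ^ e - 1) - (G - ((v * n : ℕ) : K)) ^ p ^ (l + tau p f)) /
        G ^ p ^ (l + tau p f) := by
    rw [hk, eq_div_iff (pow_ne_zero _ hG0), sub_mul, mul_assoc,
      div_mul_cancel₀ _ (pow_ne_zero _ hG0), sub_pow_char_pow, natCast_pow_char_pow]
    ring
  rw [this, norm_div, norm_pow, hGn, one_pow, div_one]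
  refine norm_sub_lt ?_ ?_
  · rw [norm_mul, norm_natCast_eq_one p hvn, one_mul, norm_sub_rev]
    exact norm_one_sub_pow_lt hf.norm_lt _
  · rw [norm_pow]
    exact pow_lt_one₀ (norm_nonneg _) hG1 (pow_ne_zero _ (Fact.out : p.Prime).ne_zero)

theorem Admissible.norm_kappa_shift_le {f : PowerSeries K} (hf : Admissible f) {k l x i : ℕ}
    (hl : l < k) (hx : p ^ l ∣ x) (hx' : ¬ p ^ (l + 1) ∣ x) :
    ‖kappa p f l (x + p ^ k * i) - kappa p f l x‖ ≤
      ‖1 - a f 0‖ ^ ((p : ℝ) ^ (k + tau p f) - (p : ℝ) ^ (l + tau p f)) := by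
  have hlk : p ^ (l + 1) ∣ p ^ k * i := (pow_dvd_pow p hl).mul_right i
  have hy : p ^ l ∣ x + p ^ k * i := dvd_add hx ((pow_dvd_pow p l.le_succ).trans hlk)
  have hy' : ¬ p ^ (l + 1) ∣ x + p ^ k * i := by rwa [Nat.dvd_add_left hlk]
  have hx0 : 0 < x := Nat.pos_of_ne_zero fun h => hx' (h ▸ dvd_zero _)
  have hux : 0 < u f * x := mul_pos hf.u_pos hx0
  have huy : 0 < u f * (x + p ^ k * i) := mul_pos hf.u_pos (by omega)
  have h1 := hf.one_sub_ne hux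
  have h2 := hf.one_sub_ne huy
  -- Multiplying by `λ`, of norm one, removes the truncated subtractions in the exponents.
  have key : a f 0 * (kappa p f l (x + p ^ k * i) - kappa p f l x) =
      (1 - a f 0 ^ p ^ (l + tau p f)) * (a f 0 ^ (u f * x) * (a f 0 ^ (u f * (p ^ k * i)) - 1)) /
        ((1 - a f 0 ^ (u f * (x + p ^ k * i))) * (1 - a f 0 ^ (u f * x))) := by
    have e1 : a f 0 * a f 0 ^ (u f * x - 1) = a f 0 ^ (u f * x) := by
      rw [← pow_succ', Nat.sub_add_cancel hux]
    have e2 : a f 0 * a f 0 ^ (u f * (x + p ^ k * i) - 1) = a f 0 ^ (u f * (x + p ^ k * i)) := by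
      rw [← pow_succ', Nat.sub_add_cancel huy]
    have e3 : a f 0 ^ (u f * (x + p ^ k * i)) =
      a f 0 ^ (u f * x) * a f 0 ^ (u f * (p ^ k * i)) := by rw [mul_add, pow_add]
    simp only [kappa]
    rw [mul_sub, mul_div_assoc', mul_div_assoc', mul_left_comm, e2, mul_left_comm, e1,
      div_sub_div _ _ h2 h1, e3]
    congr 1
    ring
  obtain ⟨v, hv, hpv⟩ := hf.u_eq p
  have h3 : ‖a f 0 ^ (u f * (p ^ k * i)) - 1‖ ≤ ‖1 - a f 0‖ ^ p ^ (k + tau p f) := by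
    rw [norm_sub_rev, hv,
      show p ^ tau p f * v * (p ^ k * i) = p ^ (k + tau p f) * (v * i) by ring]
    exact hf.norm_one_sub_pow_le p _ _
  have h4 := congrArg norm key
  rw [norm_mul, hf.norm_lam, one_mul, norm_div, norm_mul, norm_mul, norm_mul, norm_pow,
    hf.norm_lam, one_pow, one_mul, hf.norm_one_sub_u hx hx', hf.norm_one_sub_u hy hy',
    hf.norm_one_sub_char_pow p, mul_div_mul_left _ _ (pow_ne_zero _ hf.q_pos.ne')] at h4
  rw [h4, Real.rpow_sub hf.q_pos]
  rw [rpow_natCast_pow, rpow_natCast_pow]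
  gcongr

end Setting

/-! ### Slope bounds and shift bounds through the recursion -/

section Recursion

variable {K : Type*} [NormedField K] [IsUltrametricDist K]
variable {χ ψ : ℕ → ℕ → K} {κ : ℕ → K} {p l : ℕ} {Q m : ℝ}

theorem rec_norm_le (hQ : 0 < Q)
    (hrec : ∀ r s, r < s → χ r s = ψ r s +
      ∑ x ∈ Finset.Ioo r s with p ^ l ∣ x ∧ ¬ p ^ (l + 1) ∣ x, χ r x * κ x * ψ x s)
    (hκ : ∀ x, p ^ l ∣ x → ¬ p ^ (l + 1) ∣ x → ‖κ x‖ ≤ 1)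
    (hψ : ∀ r s, p ^ l ∣ r → p ^ l ∣ s → r < s → ‖ψ r s‖ ≤ Q ^ (m * ((s : ℝ) - r)))
    (r s : ℕ) (hr : p ^ l ∣ r) (hs : p ^ l ∣ s) (h : r < s) :
    ‖χ r s‖ ≤ Q ^ (m * ((s : ℝ) - r)) := by
  induction s using Nat.strong_induction_on with
  | _ s ih =>
  rw [hrec r s h]
  refine norm_add_le' (hψ r s hr hs h)
    (IsUltrametricDist.norm_sum_le_of_forall_le_of_nonneg (Real.rpow_nonneg hQ.le _)
      fun x hx => ?_)
  simp only [Finset.mem_filter, Finset.mem_Ioo] at hx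
  obtain ⟨⟨h1, h2⟩, h3, h4⟩ := hx
  rw [norm_mul, norm_mul]
  calc ‖χ r x‖ * ‖κ x‖ * ‖ψ x s‖
      ≤ Q ^ (m * ((x : ℝ) - r)) * 1 * Q ^ (m * ((s : ℝ) - x)) := by
        gcongr
        · exact ih x h2 h3 h1
        · exact hκ x h3 h4
        · exact hψ x s h3 hs h2
    _ = Q ^ (m * ((s : ℝ) - r)) := by
        rw [mul_one, ← Real.rpow_add hQ]
        congr 1
        ring

theorem sum_Ioo_shift {R : Type*} [AddCommMonoid R] (g : ℕ → R) (P : ℕ → Prop) [DecidablePred P]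
    {T : ℕ} (hP : ∀ x, P (x + T) ↔ P x) (r s : ℕ) :
    ∑ x ∈ Finset.Ioo (r + T) (s + T) with P x, g x =
      ∑ x ∈ Finset.Ioo r s with P x, g (x + T) := by
  rw [Finset.sum_filter, Finset.sum_filter, ← Finset.map_add_right_Ioo, Finset.sum_map]
  simp [hP]

/-- Translation by `T` preserves the set of allowed vertices, so the two sums match term by term.
Each product changes one factor at a time, each change contributing `Q ^ e`. -/
theorem rec_shift_le (hQ : 0 < Q) {e : ℝ} {T : ℕ} (hT : p ^ (l + 1) ∣ T)
    (hrec : ∀ r s, r < s → χ r s = ψ r s +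
      ∑ x ∈ Finset.Ioo r s with p ^ l ∣ x ∧ ¬ p ^ (l + 1) ∣ x, χ r x * κ x * ψ x s)
    (hκ : ∀ x, p ^ l ∣ x → ¬ p ^ (l + 1) ∣ x → ‖κ x‖ ≤ 1)
    (hκ' : ∀ x, p ^ l ∣ x → ¬ p ^ (l + 1) ∣ x → ‖κ (x + T) - κ x‖ ≤ Q ^ e)
    (hψ : ∀ r s, p ^ l ∣ r → p ^ l ∣ s → r < s → ‖ψ r s‖ ≤ Q ^ (m * ((s : ℝ) - r)))
    (hψ' : ∀ r s, p ^ l ∣ r → p ^ l ∣ s → r < s →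
      ‖ψ (r + T) (s + T) - ψ r s‖ ≤ Q ^ (m * ((s : ℝ) - r) + e))
    (r s : ℕ) (hr : p ^ l ∣ r) (hs : p ^ l ∣ s) (h : r < s) :
    ‖χ (r + T) (s + T) - χ r s‖ ≤ Q ^ (m * ((s : ℝ) - r) + e) := by
  have hχ := rec_norm_le hQ hrec hκ hψ
  have hTl : p ^ l ∣ T := (pow_dvd_pow p l.le_succ).trans hT
  induction s using Nat.strong_induction_on with
  | _ s ih =>
  have hP (x : ℕ) : (p ^ l ∣ x + T ∧ ¬ p ^ (l + 1) ∣ x + T) ↔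
      (p ^ l ∣ x ∧ ¬ p ^ (l + 1) ∣ x) := by
    rw [Nat.dvd_add_left hTl, Nat.dvd_add_left hT]
  rw [hrec r s h, hrec (r + T) (s + T) (by omega),
    sum_Ioo_shift (fun x => χ (r + T) x * κ x * ψ x (s + T)) _ hP, add_sub_add_comm,
    ← Finset.sum_sub_distrib]
  refine norm_add_le' (hψ' r s hr hs h)
    (IsUltrametricDist.norm_sum_le_of_forall_le_of_nonneg (Real.rpow_nonneg hQ.le _)
      fun x hx => ?_)
  simp only [Finset.mem_filter, Finset.mem_Ioo] at hx
  obtain ⟨⟨h1, h2⟩, h3, h4⟩ := hx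
  have h5 : ‖κ (x + T)‖ ≤ 1 := hκ _ ((hP x).2 ⟨h3, h4⟩).1 ((hP x).2 ⟨h3, h4⟩).2
  have h6 : ‖ψ (x + T) (s + T)‖ ≤ Q ^ (m * ((s : ℝ) - x)) := by
    have := hψ (x + T) (s + T) (dvd_add h3 hTl) (dvd_add hs hTl) (by omega)
    simpa using this
  have hexp : Q ^ (m * ((s : ℝ) - r) + e) =
      Q ^ (m * ((x : ℝ) - r)) * Q ^ (m * ((s : ℝ) - x)) * Q ^ e := by
    rw [← Real.rpow_add hQ, ← Real.rpow_add hQ]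
    congr 1
    ring
  have hsplit : χ (r + T) (x + T) * κ (x + T) * ψ (x + T) (s + T) - χ r x * κ x * ψ x s =
      (χ (r + T) (x + T) - χ r x) * κ (x + T) * ψ (x + T) (s + T) +
      (χ r x * (κ (x + T) - κ x) * ψ (x + T) (s + T) +
        χ r x * κ x * (ψ (x + T) (s + T) - ψ x s)) := by ring
  rw [hsplit, hexp]
  refine norm_add_le' ?_ (norm_add_le' ?_ ?_)
  · rw [norm_mul, norm_mul]
    calc _ ≤ Q ^ (m * ((x : ℝ) - r) + e) * 1 * Q ^ (m * ((s : ℝ) - x)) := by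
          gcongr
          exact ih x h2 h3 h1
      _ = _ := by rw [Real.rpow_add hQ]; ring
  · rw [norm_mul, norm_mul]
    calc _ ≤ Q ^ (m * ((x : ℝ) - r)) * Q ^ e * Q ^ (m * ((s : ℝ) - x)) := by
          gcongr
          · exact hχ r x hr h3 h1
          · exact hκ' x h3 h4
      _ = _ := by ring
  · rw [norm_mul, norm_mul]
    calc _ ≤ Q ^ (m * ((x : ℝ) - r)) * 1 * Q ^ (m * ((s : ℝ) - x) + e) := by
          gcongr
          · exact hχ r x hr h3 h1
          · exact hκ x h3 h4
          · exact hψ' x s h3 hs h2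
      _ = _ := by rw [Real.rpow_add hQ]; ring

end Recursion

/-! ### Power series with coefficients of prescribed decay -/

section WeightedBound

open PowerSeries

variable {K : Type*} [NormedField K]

/-- The coefficients of `g` satisfy `‖gₙ‖ ≤ Q ^ (c n + e)`. -/
def WeightedBound (Q c e : ℝ) (g : PowerSeries K) : Prop :=
  ∀ n : ℕ, ‖coeff n g‖ ≤ Q ^ (c * n + e)

variable {Q c e e' : ℝ} {g h : PowerSeries K}

theorem WeightedBound.mono (hQ : 0 < Q) (hQ1 : Q ≤ 1) (hg : WeightedBound Q c e g) (h : e' ≤ e) :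
    WeightedBound Q c e' g := fun n =>
  (hg n).trans (Real.rpow_le_rpow_of_exponent_ge hQ hQ1 (by linarith))

theorem weightedBound_one (hQ : 0 < Q) : WeightedBound Q c 0 (1 : PowerSeries K) := fun n => by
  rw [coeff_one]
  split_ifs with hn
  · simp [hn]
  · simpa using Real.rpow_nonneg hQ.le _

variable [IsUltrametricDist K]

theorem WeightedBound.add (hg : WeightedBound Q c e g) (hh : WeightedBound Q c e h) :
    WeightedBound Q c e (g + h) := fun n => by
  rw [map_add]
  exact norm_add_le' (hg n) (hh n)

theorem WeightedBound.mul (hQ : 0 < Q) (hg : WeightedBound Q c e g) (hh : WeightedBound Q c e' h) :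
    WeightedBound Q c (e + e') (g * h) := fun n => by
  rw [coeff_mul]
  refine IsUltrametricDist.norm_sum_le_of_forall_le_of_nonneg (Real.rpow_nonneg hQ.le _)
    fun x hx => ?_
  rw [Finset.HasAntidiagonal.mem_antidiagonal] at hx
  rw [norm_mul, ← hx, Nat.cast_add,
    show c * ((x.1 : ℝ) + x.2) + (e + e') = (c * x.1 + e) + (c * x.2 + e') by ring,
    Real.rpow_add hQ]
  exact mul_le_mul (hg _) (hh _) (norm_nonneg _) (Real.rpow_nonneg hQ.le _)

theorem WeightedBound.pow (hQ : 0 < Q) (hg : WeightedBound Q c e g) (N : ℕ) :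
    WeightedBound Q c (N * e) (g ^ N) := by
  induction N with
  | zero => simpa using weightedBound_one hQ
  | succ N ih =>
    rw [pow_succ]
    convert! ih.mul hQ hg using 1
    push_cast
    ring

theorem WeightedBound.pow_of_zero (hQ : 0 < Q) (hg : WeightedBound Q c 0 g) (N : ℕ) :
    WeightedBound Q c 0 (g ^ N) := by
  simpa using hg.pow hQ N

theorem WeightedBound.pow_sub_one (hQ : 0 < Q) (hQ1 : Q ≤ 1) (he : 0 ≤ e)
    (hg : WeightedBound Q c e (g - 1)) (N : ℕ) : WeightedBound Q c e (g ^ N - 1) := by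
  have hg0 : WeightedBound Q c 0 g := by
    have := (hg.mono hQ hQ1 he).add (weightedBound_one hQ)
    rwa [sub_add_cancel] at this
  induction N with
  | zero =>
    intro n
    simpa using Real.rpow_nonneg hQ.le _
  | succ N ih =>
    have h1 := (hg0.mul hQ ih).add (e := 0 + e) (by simpa using hg)
    rw [zero_add] at h1
    convert! h1 using 1
    ring

end WeightedBound

/-! ### Near-invariance of `ψ_l` under shifts by multiples of `p ^ k` -/

section Shift

open PowerSeries

variable {K : Type*} [NormedField K] [IsUltrametricDist K] {p : ℕ} [Fact p.Prime]
  {f : PowerSeries K} {m : ℝ}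

theorem Admissible.psi_zero (hf : Admissible f) {r s : ℕ} (h : r < s) :
    psi p f 0 r s = coeff (u f * (s - r)) (PowerSeries.mk (a f) ^ (u f * r + 1)) /
      ((1 - a f 0 ^ p ^ tau p f) * a f 0 ^ (u f * s)) := by
  have hs : 0 < u f * s := mul_pos hf.u_pos (by omega)
  have h1 := hf.one_sub_ne hs
  have h2 := hf.one_sub_ne (pow_pos (Fact.out : p.Prime).pos (tau p f))
  have h3 := pow_ne_zero (u f * s - 1) hf.lam_ne
  have h4 := hf.lam_ne
  have e1 : a f 0 ^ (u f * s) = a f 0 * a f 0 ^ (u f * s - 1) := by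
    rw [← pow_succ', Nat.sub_add_cancel hs]
  rw [psi, phi_zero p f r s h, Phi_eq hf.exists_ne, ← Nat.mul_sub, zero_add, e1]
  rw [e1] at h1
  generalize a f 0 ^ (u f * s - 1) = x at *
  field_simp

variable [CharP K p]

/-- The offset `1` is dictated by the constant term, of norm exactly `Q`. The other coefficients are
read off from `ψ_0(0, j)`, with offset `p^τ ≥ 1`. -/
theorem Admissible.weightedBound_sub_one (hf : Admissible f)
    (hψ : ∀ r s, r < s → ‖psi p f 0 r s‖ ≤ ‖1 - a f 0‖ ^ (m * ((s : ℝ) - r))) :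
    WeightedBound ‖1 - a f 0‖ (m / u f) 1 (PowerSeries.mk (a f) - 1) := by
  have hQ := hf.q_pos
  intro n
  rcases Nat.eq_zero_or_pos n with rfl | hn
  · simp [norm_sub_rev]
  rw [map_sub, coeff_mk, coeff_one, if_neg hn.ne', sub_zero]
  by_cases ha : a f n = 0
  · rw [ha, norm_zero]
    exact Real.rpow_nonneg hQ.le _
  obtain ⟨j, rfl⟩ := u_mem hf.exists_ne n hn ha
  have hj : 0 < j := Nat.pos_of_mul_pos_left hn
  have h1 := hψ 0 j hj
  rw [hf.psi_zero hj, norm_div, norm_mul, norm_pow, hf.norm_lam, one_pow, mul_one,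
    hf.norm_one_sub_char_pow p, div_le_iff₀ (pow_pos hQ _)] at h1
  simp only [mul_zero, zero_add, pow_one, Nat.sub_zero, coeff_mk, Nat.cast_zero, sub_zero] at h1
  refine h1.trans ?_
  rw [Real.rpow_add hQ, Real.rpow_one]
  have hu : (u f : ℝ) ≠ 0 := by exact_mod_cast hf.u_pos.ne'
  have e : m / (u f : ℝ) * ((u f * j : ℕ) : ℝ) = m * j := by
    push_cast
    field_simp
  rw [e]
  gcongr
  exact pow_le_of_le_one hQ.le hf.norm_lt.le (pow_ne_zero _ (Fact.out : p.Prime).ne_zero)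

/-- A shift by `T = p^k i` multiplies the series by `G^(uT)`, a `p^(k+τ)`-th power. Frobenius raises
the offset of its distance to `1` from `1` to `p^(k+τ)`. -/
theorem Admissible.psi_zero_shift_le (hf : Admissible f)
    (hψ : ∀ r s, r < s → ‖psi p f 0 r s‖ ≤ ‖1 - a f 0‖ ^ (m * ((s : ℝ) - r))) (k i : ℕ)
    {r s : ℕ} (h : r < s) :
    ‖psi p f 0 (r + p ^ k * i) (s + p ^ k * i) - psi p f 0 r s‖ ≤
      ‖1 - a f 0‖ ^ (m * ((s : ℝ) - r) +
        ((p : ℝ) ^ (k + tau p f) - (p : ℝ) ^ (0 + tau p f))) := by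
  have hQ := hf.q_pos
  have hQ1 := hf.norm_lt.le
  have hW := hf.weightedBound_sub_one hψ
  set G : PowerSeries K := PowerSeries.mk (a f) with hG
  set T := p ^ k * i with hT
  obtain ⟨v, hv, hpv⟩ := hf.u_eq p
  have huT : u f * T = (v * i) * p ^ (k + tau p f) := by rw [hv, hT]; ring
  have hu : (u f : ℝ) ≠ 0 := by exact_mod_cast hf.u_pos.ne'
  have hG0 : WeightedBound ‖1 - a f 0‖ (m / u f) 0 G := by
    have := (hW.mono hQ hQ1 zero_le_one).add (weightedBound_one hQ)
    rwa [sub_add_cancel] at this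
  have hWT : WeightedBound ‖1 - a f 0‖ (m / u f) ((p : ℝ) ^ (k + tau p f)) (G ^ (u f * T) - 1) := by
    have h1 := (hW.pow_sub_one hQ hQ1 zero_le_one (v * i)).pow hQ (p ^ (k + tau p f))
    have : CharP (PowerSeries K) p :=
      charP_of_injective_algebraMap (algebraMap K (PowerSeries K)).injective p
    rw [sub_pow_char_pow, one_pow, ← pow_mul, ← huT] at h1
    simpa using h1
  have hdeg : m / (u f : ℝ) * ((u f * (s - r) : ℕ) : ℝ) = m * ((s : ℝ) - r) := by
    rw [Nat.cast_mul, Nat.cast_sub h.le]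
    field_simp
  have hA := hG0.pow_of_zero hQ (u f * r + 1) (u f * (s - r))
  have hAT := ((hG0.pow_of_zero hQ (u f * r + 1)).mul hQ hWT) (u f * (s - r))
  rw [hdeg] at hA hAT
  rw [add_zero] at hA
  rw [zero_add, mul_sub, mul_one, ← pow_add, map_sub,
    show u f * r + 1 + u f * T = u f * (r + T) + 1 by ring] at hAT
  have hlT : ‖a f 0 ^ (u f * T) - 1‖ ≤ ‖1 - a f 0‖ ^ ((p : ℝ) ^ (k + tau p f)) := by
    rw [norm_sub_rev, huT, mul_comm, rpow_natCast_pow]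
    exact hf.norm_one_sub_pow_le p _ _
  rw [hf.psi_zero h, hf.psi_zero (show r + T < s + T by omega), Nat.add_sub_add_right, ← hG]
  set A := coeff (u f * (s - r)) (G ^ (u f * r + 1))
  set A' := coeff (u f * (s - r)) (G ^ (u f * (r + T) + 1))
  have h2 := hf.one_sub_ne (pow_pos (Fact.out : p.Prime).pos (tau p f))
  have h3 := pow_ne_zero (u f * s) hf.lam_ne
  have h4 := pow_ne_zero (u f * T) hf.lam_ne
  have key : A' / ((1 - a f 0 ^ p ^ tau p f) * a f 0 ^ (u f * (s + T))) -
      A / ((1 - a f 0 ^ p ^ tau p f) * a f 0 ^ (u f * s)) =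
      ((A' - A) - A * (a f 0 ^ (u f * T) - 1)) /
        ((1 - a f 0 ^ p ^ tau p f) * a f 0 ^ (u f * (s + T))) := by
    rw [mul_add, pow_add]
    field_simp
    ring
  rw [key, norm_div, norm_mul, norm_pow, hf.norm_lam, one_pow, mul_one,
    hf.norm_one_sub_char_pow p, ← rpow_natCast_pow, zero_add, ← add_sub_assoc, Real.rpow_sub hQ]
  refine div_le_div_of_nonneg_right (norm_sub_le' hAT ?_) (Real.rpow_nonneg hQ.le _)
  rw [norm_mul, Real.rpow_add hQ]
  exact mul_le_mul hA hlT (norm_nonneg _) (Real.rpow_nonneg hQ.le _)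

theorem Admissible.norm_psi_succ (hf : Admissible f) (l r : ℕ) {s : ℕ} (hs : 0 < s) :
    ‖psi p f (l + 1) r s‖ = ‖chi p f l r s‖ *
      ‖1 - a f 0‖ ^ ((p : ℝ) ^ (l + tau p f) - (p : ℝ) ^ (l + 1 + tau p f)) := by
  rw [hf.psi_succ l r hs, norm_mul, norm_div, hf.norm_one_sub_char_pow p,
    hf.norm_one_sub_char_pow p, Real.rpow_sub hf.q_pos, rpow_natCast_pow, rpow_natCast_pow]

theorem Admissible.norm_chi_le (hf : Admissible f) {l : ℕ}
    (hψ : ∀ r s, p ^ l ∣ r → p ^ l ∣ s → r < s →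
      ‖psi p f l r s‖ ≤ ‖1 - a f 0‖ ^ (m * ((s : ℝ) - r)))
    (r s : ℕ) (hr : p ^ l ∣ r) (hs : p ^ l ∣ s) (h : r < s) :
    ‖chi p f l r s‖ ≤ ‖1 - a f 0‖ ^ (m * ((s : ℝ) - r)) :=
  rec_norm_le hf.q_pos (fun _ _ h => hf.chi_rec l h) (fun _ h h' => (hf.norm_kappa h h').le) hψ
    r s hr hs h

/-- The recursion at level `l` preserves the shift error, and renormalization costs `p^(l+1+τ) -
p^(l+τ)`. At `l = k` the gain is used up, leaving exactly `m (s - r)`. -/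
theorem Admissible.psi_shift_le (hf : Admissible f) {k : ℕ} (hk : 1 ≤ k)
    (hψ : ∀ l < k, ∀ r s, p ^ l ∣ r → p ^ l ∣ s → r < s →
      ‖psi p f l r s‖ ≤ ‖1 - a f 0‖ ^ (m * ((s : ℝ) - r)))
    (i l : ℕ) (hl : l ≤ k) (r s : ℕ) (hr : p ^ l ∣ r) (hs : p ^ l ∣ s) (h : r < s) :
    ‖psi p f l (r + p ^ k * i) (s + p ^ k * i) - psi p f l r s‖ ≤
      ‖1 - a f 0‖ ^ (m * ((s : ℝ) - r) +
        ((p : ℝ) ^ (k + tau p f) - (p : ℝ) ^ (l + tau p f))) := by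
  have hQ := hf.q_pos
  induction l generalizing r s with
  | zero => exact hf.psi_zero_shift_le (fun r s => hψ 0 hk r s (by simp) (by simp)) k i h
  | succ l ih =>
    have hlk : l < k := hl
    have h1 := rec_shift_le hQ (T := p ^ k * i) ((pow_dvd_pow p hl).mul_right i)
      (fun _ _ h => hf.chi_rec l h) (fun _ h h' => (hf.norm_kappa h h').le)
      (fun _ h h' => hf.norm_kappa_shift_le hlk h h') (hψ l hlk) (ih hlk.le) r s
      ((pow_dvd_pow p l.le_succ).trans hr) ((pow_dvd_pow p l.le_succ).trans hs) h
    rw [hf.psi_succ l _ (show 0 < s + p ^ k * i by omega), hf.psi_succ l r (by omega), ← sub_mul,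
      norm_mul, norm_div, hf.norm_one_sub_char_pow p, hf.norm_one_sub_char_pow p,
      ← rpow_natCast_pow, ← rpow_natCast_pow, ← Real.rpow_sub hQ]
    refine (mul_le_mul_of_nonneg_right h1 (Real.rpow_nonneg hQ.le _)).trans_eq ?_
    rw [← Real.rpow_add hQ]
    congr 1
    ring

end Shift

/-! ### An obstruction to solving `x y' = W y` in characteristic `p` -/

section EulerOperator

open PowerSeries

variable {K : Type*} [NormedField K]

/-- The Euler operator `x d/dx` on power series. -/
noncomputable def euler (g : PowerSeries K) : PowerSeries K :=
  PowerSeries.mk fun n => (n : K) * coeff n g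

theorem coeff_euler (g : PowerSeries K) (n : ℕ) : coeff n (euler g) = n * coeff n g :=
  coeff_mk _ _

theorem euler_add (g h : PowerSeries K) : euler (g + h) = euler g + euler h := by
  ext n
  simp only [coeff_euler, map_add]
  ring

theorem euler_mul (g h : PowerSeries K) : euler (g * h) = euler g * h + g * euler h := by
  ext n
  simp only [coeff_euler, map_add, coeff_mul, Finset.mul_sum]
  rw [← Finset.sum_add_distrib]
  refine Finset.sum_congr rfl fun x hx => ?_
  rw [Finset.HasAntidiagonal.mem_antidiagonal] at hx
  rw [← hx]
  push_cast
  ring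

theorem coeff_euler_iterate (g : PowerSeries K) (j n : ℕ) :
    coeff n (euler^[j] g) = (n : K) ^ j * coeff n g := by
  induction j with
  | zero => simp
  | succ j ih =>
    rw [Function.iterate_succ_apply', coeff_euler, ih]
    ring

theorem euler_iterate_char (p : ℕ) [Fact p.Prime] [CharP K p] (g : PowerSeries K) :
    euler^[p] g = euler g := by
  ext n
  rw [coeff_euler_iterate, coeff_euler, natCast_pow_char]

/-- The series `Pⱼ` for which `euler Y = W Y` implies `euler^j Y = Pⱼ Y`. -/
noncomputable def eulerIter (W : PowerSeries K) : ℕ → PowerSeries K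
  | 0 => 1
  | j + 1 => euler (eulerIter W j) + W * eulerIter W j

theorem coeff_eulerIter_eq_zero {W : PowerSeries K} {e : ℕ} (hW : ∀ n, e < n → coeff n W = 0)
    (j n : ℕ) (hn : j * e < n) : coeff n (eulerIter W j) = 0 := by
  induction j generalizing n with
  | zero =>
    rw [eulerIter, coeff_one, if_neg (by omega)]
  | succ j ih =>
    have hn' : j * e + e < n := by linarith
    rw [eulerIter, map_add, coeff_euler, ih n (by omega), mul_zero, zero_add, coeff_mul]
    refine Finset.sum_eq_zero fun x hx => ?_
    rw [Finset.HasAntidiagonal.mem_antidiagonal] at hx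
    by_cases h : e < x.1
    · rw [hW _ h, zero_mul]
    · rw [ih x.2 (by omega), mul_zero]

theorem coeff_eulerIter_top {W : PowerSeries K} {e : ℕ} (he : 0 < e)
    (hW : ∀ n, e < n → coeff n W = 0) (j : ℕ) :
    coeff (j * e) (eulerIter W j) = coeff e W ^ j := by
  induction j with
  | zero => simp [eulerIter]
  | succ j ih =>
    have hz := coeff_eulerIter_eq_zero hW j
    rw [eulerIter, map_add, coeff_euler, hz _ (by nlinarith), mul_zero, zero_add, coeff_mul,
      Finset.sum_eq_single (e, j * e)]
    · rw [ih, pow_succ']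
    · intro x hx hne
      rw [Finset.HasAntidiagonal.mem_antidiagonal, Nat.succ_mul] at hx
      by_cases h : e < x.1
      · rw [hW _ h, zero_mul]
      · rw [hz x.2, mul_zero]
        by_contra h2
        exact hne (Prod.ext (by simp only; omega) (by simp only; omega))
    · intro h
      rw [Finset.HasAntidiagonal.mem_antidiagonal] at h
      exact absurd (by ring) h

/-- `‖gₙ‖ ≤ σⁿ` for all `n`. -/
def GeomBound (σ : ℝ) (g : PowerSeries K) : Prop := ∀ n, ‖coeff n g‖ ≤ σ ^ n

/-- `‖gₙ‖ < σⁿ` for all `n < N`. -/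
def GeomSmall (σ : ℝ) (N : ℕ) (g : PowerSeries K) : Prop := ∀ n < N, ‖coeff n g‖ < σ ^ n

variable [IsUltrametricDist K] {σ : ℝ} {N : ℕ} {g h : PowerSeries K}

theorem GeomBound.add (hg : GeomBound σ g) (hh : GeomBound σ h) : GeomBound σ (g + h) := fun n => by
  rw [map_add]
  exact norm_add_le' (hg n) (hh n)

theorem GeomBound.euler (hg : GeomBound σ g) : GeomBound σ (euler g) := fun n => by
  rw [coeff_euler, norm_mul]
  exact (mul_le_mul (IsUltrametricDist.norm_natCast_le_one K n) (hg n) (norm_nonneg _)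
    zero_le_one).trans_eq (one_mul _)

theorem GeomBound.mul (hσ : 0 < σ) (hg : GeomBound σ g) (hh : GeomBound σ h) :
    GeomBound σ (g * h) := fun n => by
  rw [coeff_mul]
  refine IsUltrametricDist.norm_sum_le_of_forall_le_of_nonneg (pow_nonneg hσ.le _) fun x hx => ?_
  rw [Finset.HasAntidiagonal.mem_antidiagonal] at hx
  rw [norm_mul, ← hx, pow_add]
  exact mul_le_mul (hg _) (hh _) (norm_nonneg _) (pow_nonneg hσ.le _)

theorem geomBound_eulerIter (hσ : 0 < σ) (hg : GeomBound σ g) (j : ℕ) :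
    GeomBound σ (eulerIter g j) := by
  induction j with
  | zero =>
    intro n
    rw [eulerIter, coeff_one]
    split_ifs with hn
    · simp [hn]
    · simpa using pow_nonneg hσ.le _
  | succ j ih => exact ih.euler.add (hg.mul hσ ih)

theorem GeomSmall.add (hg : GeomSmall σ N g) (hh : GeomSmall σ N h) : GeomSmall σ N (g + h) :=
  fun n hn => by
    rw [map_add]
    exact norm_add_lt (hg n hn) (hh n hn)

theorem GeomSmall.sub (hg : GeomSmall σ N g) (hh : GeomSmall σ N h) : GeomSmall σ N (g - h) :=
  fun n hn => by
    rw [map_sub]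
    exact norm_sub_lt (hg n hn) (hh n hn)

theorem GeomSmall.euler (hg : GeomSmall σ N g) : GeomSmall σ N (euler g) := fun n hn => by
  rw [coeff_euler, norm_mul]
  exact (mul_le_of_le_one_left (norm_nonneg _)
    (IsUltrametricDist.norm_natCast_le_one K n)).trans_lt (hg n hn)

theorem GeomSmall.mul (hσ : 0 < σ) (hg : GeomBound σ g) (hh : GeomSmall σ N h) :
    GeomSmall σ N (g * h) := fun n hn => by
  rw [coeff_mul]
  refine norm_sum_lt (pow_pos hσ _) fun x hx => ?_
  rw [Finset.HasAntidiagonal.mem_antidiagonal] at hx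
  rw [norm_mul, ← hx, pow_add]
  exact mul_lt_mul' (hg _) (hh _ (by omega)) (norm_nonneg _) (pow_pos hσ _)

/-- A factor with constant term `1` can be cancelled, since the system for the coefficients of `g`
is triangular. -/
theorem GeomSmall.of_mul (hσ : 0 < σ) (hh0 : coeff 0 h = 1) (hh : GeomBound σ h)
    (hgh : GeomSmall σ N (g * h)) : GeomSmall σ N g := fun n hn => by
  induction n using Nat.strong_induction_on with
  | _ n ih =>
  have h1 := hgh n hn
  have h2 : coeff n g = coeff n (g * h) - ∑ x ∈ (Finset.HasAntidiagonal.antidiagonal n).erase (n, 0),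
      coeff x.1 g * coeff x.2 h := by
    rw [coeff_mul, ← Finset.add_sum_erase _ _
      (show (n, 0) ∈ Finset.HasAntidiagonal.antidiagonal n by simp), hh0]
    ring
  rw [h2]
  refine norm_sub_lt h1 (norm_sum_lt (pow_pos hσ _) fun x hx => ?_)
  rw [Finset.mem_erase, Finset.HasAntidiagonal.mem_antidiagonal] at hx
  have hx1 : x.1 < n := by
    by_contra hlt
    exact hx.1 (Prod.ext (by simp only; omega) (by simp only; omega))
  rw [norm_mul, ← hx.2, pow_add]
  exact (mul_le_mul_of_nonneg_left (hh _) (norm_nonneg _)).trans_lt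
    (mul_lt_mul_of_pos_right (ih _ hx1 (by omega)) (pow_pos hσ _))

theorem euler_iterate_approx (hσ : 0 < σ) {W Y : PowerSeries K} (hW : GeomBound σ W)
    (hY : GeomSmall σ N (euler Y - W * Y)) (j : ℕ) :
    GeomSmall σ N (euler^[j] Y - eulerIter W j * Y) := by
  induction j with
  | zero =>
    intro n _
    simpa [eulerIter] using pow_pos hσ n
  | succ j ih =>
    have h1 := ih.euler.add (GeomSmall.mul hσ (geomBound_eulerIter hσ hW j) hY)
    convert! h1 using 1
    have h2 : euler (euler^[j] Y) = euler (euler^[j] Y - eulerIter W j * Y) +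
        euler (eulerIter W j * Y) := by
      rw [← euler_add, sub_add_cancel]
    rw [Function.iterate_succ_apply', h2, euler_mul, eulerIter]
    ring

/-- In characteristic `p`, the equation `x y' = W y` with `W` a polynomial of degree `< p` without
constant term has no solution modulo `x ^ p²` and modulo small terms. -/
theorem not_approx_euler_eq (p : ℕ) [Fact p.Prime] [CharP K p] (hσ : 0 < σ) {y w : ℕ → K}
    (hy0 : y 0 = 1) (hy : ∀ n, ‖y n‖ ≤ σ ^ n)
    (hw : ∀ d ∈ Finset.Icc 1 (p - 1), ‖w d‖ ≤ σ ^ d)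
    (hw' : ∃ d ∈ Finset.Icc 1 (p - 1), ‖w d‖ = σ ^ d)
    (h : ∀ n < p ^ 2,
      ‖(n : K) * y n - ∑ d ∈ Finset.Icc 1 (p - 1) with d ≤ n, w d * y (n - d)‖ < σ ^ n) :
    False := by
  classical
  have hp2 := (Fact.out : p.Prime).two_le
  -- `e` is the largest degree in which `w` attains its bound; terms beyond `e` are small and are
  -- dropped from `W`.
  obtain ⟨e, he, hmax⟩ := Finset.exists_max_image
    {d ∈ Finset.Icc 1 (p - 1) | ‖w d‖ = σ ^ d} id
    (by obtain ⟨d, hd, hd'⟩ := hw'; exact ⟨d, Finset.mem_filter.2 ⟨hd, hd'⟩⟩)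
  simp only [Finset.mem_filter, Finset.mem_Icc, id] at he hmax hw
  obtain ⟨⟨he1, hep⟩, hwe⟩ := he
  set W : PowerSeries K := PowerSeries.mk fun d => if 1 ≤ d ∧ d ≤ e then w d else 0 with hWdef
  set Y : PowerSeries K := PowerSeries.mk y with hYdef
  have hYB : GeomBound σ Y := fun n => by simpa [hYdef] using hy n
  have hWB : GeomBound σ W := fun n => by
    rw [hWdef, coeff_mk]
    split_ifs with hn
    · exact hw n ⟨hn.1, by omega⟩
    · simpa using pow_nonneg hσ.le n
  have hWz : ∀ n, e < n → coeff n W = 0 := fun n hn => by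
    rw [hWdef, coeff_mk, if_neg (by omega)]
  have hWe : coeff e W = w e := by
    rw [hWdef, coeff_mk, if_pos ⟨he1, le_rfl⟩]
  have hWY (n : ℕ) : coeff n (W * Y) =
      ∑ d ∈ Finset.Icc 1 (p - 1) with d ≤ n, if d ≤ e then w d * y (n - d) else 0 := by
    rw [coeff_mul, Finset.Nat.sum_antidiagonal_eq_sum_range_succ_mk, ← Finset.sum_filter,
      ← Finset.sum_filter_add_sum_filter_not (Finset.range n.succ) (fun d => 1 ≤ d ∧ d ≤ e)]
    rw [Finset.sum_eq_zero (s := Finset.filter (fun d => ¬ (1 ≤ d ∧ d ≤ e)) _), add_zero]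
    · refine Finset.sum_congr ?_ fun d hd => ?_
      · ext d
        simp only [Finset.mem_filter, Finset.mem_range, Finset.mem_Icc]
        omega
      · simp only [Finset.mem_filter, Finset.mem_Icc] at hd
        rw [hWdef, hYdef, coeff_mk, coeff_mk, if_pos (by omega)]
    · intro d hd
      rw [Finset.mem_filter] at hd
      rw [hWdef, coeff_mk, if_neg hd.2, zero_mul]
  have hsmall : GeomSmall σ (p ^ 2) (euler Y - W * Y) := fun n hn => by
    have : coeff n (euler Y - W * Y) =
        ((n : K) * y n - ∑ d ∈ Finset.Icc 1 (p - 1) with d ≤ n, w d * y (n - d)) +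
          ∑ d ∈ Finset.Icc 1 (p - 1) with d ≤ n, if d ≤ e then 0 else w d * y (n - d) := by
      rw [map_sub, coeff_euler, hWY, hYdef, coeff_mk, sub_add, ← Finset.sum_sub_distrib]
      congr 1
      refine Finset.sum_congr rfl fun d _ => ?_
      split_ifs <;> simp
    rw [this]
    refine norm_add_lt (h n hn) (norm_sum_lt (pow_pos hσ _) fun d hd => ?_)
    simp only [Finset.mem_filter, Finset.mem_Icc] at hd
    split_ifs with hde
    · simpa using pow_pos hσ n
    · have h1 : ‖w d‖ < σ ^ d := lt_of_le_of_ne (hw d hd.1) fun h' => hde (hmax d ⟨hd.1, h'⟩)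
      rw [norm_mul]
      calc ‖w d‖ * ‖y (n - d)‖ ≤ ‖w d‖ * σ ^ (n - d) := by gcongr; exact hy _
        _ < σ ^ d * σ ^ (n - d) := by gcongr
        _ = σ ^ n := by rw [← pow_add, Nat.add_sub_cancel' hd.2]
  -- Both `D Y ≈ W Y` and `D^p Y ≈ P_p Y` hold, and `D^p = D`.
  have h1 := hsmall.sub (euler_iterate_approx hσ hWB hsmall p)
  rw [euler_iterate_char p] at h1
  have h2 : GeomSmall σ (p ^ 2) ((eulerIter W p - W) * Y) := by
    convert! h1 using 1
    ring
  have hpe : p * e < p ^ 2 := by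
    rw [pow_two]
    exact Nat.mul_lt_mul_of_pos_left (by omega) (by omega)
  -- In degree `p e` the polynomial `W` vanishes, while `P_p` has coefficient `w_e^p`, of norm
  -- exactly `σ^(p e)`.
  have h3 := h2.of_mul hσ (by simp [hYdef, hy0]) hYB (p * e) hpe
  rw [map_sub, coeff_eulerIter_top he1 hWz, hWz (p * e) (by nlinarith), sub_zero, hWe, norm_pow,
    hwe, ← pow_mul, mul_comm] at h3
  exact lt_irrefl _ h3

end EulerOperator

/-! ### Dominance in terms of real exponents -/

section Dominance

variable {K : Type*} [NormedField K]

/-- Dominance at level `k`, with `m` a common lower bound for the slopes below level `k` and `m'`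
the least of the slopes of `ψ_k(0, d p ^ k)` for `1 ≤ d < p`. -/
structure RealDominant (p : ℕ) (f : PowerSeries K) (k : ℕ) (m m' : ℝ) : Prop where
  bound : ∀ l < k, ∀ r s, p ^ l ∣ r → p ^ l ∣ s → r < s →
    ‖psi p f l r s‖ ≤ ‖1 - a f 0‖ ^ (m * ((s : ℝ) - r))
  gap : m' ≤ m - (p : ℝ) ^ ((tau p f : ℤ) - 1)
  le : ∀ d ∈ Finset.Icc 1 (p - 1),
    ‖psi p f k 0 (d * p ^ k)‖ ≤ ‖1 - a f 0‖ ^ (m' * ((d * p ^ k : ℕ) : ℝ))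
  attained : ∃ d ∈ Finset.Icc 1 (p - 1),
    ‖psi p f k 0 (d * p ^ k)‖ = ‖1 - a f 0‖ ^ (m' * ((d * p ^ k : ℕ) : ℝ))

theorem RealDominant.lt {p : ℕ} [Fact p.Prime] {f : PowerSeries K} {k : ℕ} {m m' : ℝ}
    (h : RealDominant p f k m m') : m' < m := by
  have : (0 : ℝ) < (p : ℝ) ^ ((tau p f : ℤ) - 1) :=
    zpow_pos (by exact_mod_cast (Fact.out : p.Prime).pos) _
  linarith [h.gap]

theorem exists_min_slope {ι : Type*} {s : Finset ι} {x : ι → K} {D : ι → ℝ} {Q : ℝ} (hQ : 0 < Q)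
    (hQ1 : Q < 1) (hD : ∀ i ∈ s, 0 < D i) (hx : ∃ i ∈ s, x i ≠ 0) :
    ∃ m : ℝ, (∀ i ∈ s, ‖x i‖ ≤ Q ^ (m * D i)) ∧ ∃ i ∈ s, ‖x i‖ = Q ^ (m * D i) := by
  classical
  have hval {i : ι} (hi : i ∈ s) (hxi : x i ≠ 0) : ‖x i‖ = Q ^ (Real.logb Q ‖x i‖ / D i * D i) := by
    rw [div_mul_cancel₀ _ (hD i hi).ne', Real.rpow_logb hQ hQ1.ne (norm_pos_iff.2 hxi)]
  obtain ⟨j, hj, hmin⟩ := Finset.exists_min_image {i ∈ s | x i ≠ 0}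
    (fun i => Real.logb Q ‖x i‖ / D i)
    (by obtain ⟨i, hi, hi'⟩ := hx; exact ⟨i, Finset.mem_filter.2 ⟨hi, hi'⟩⟩)
  rw [Finset.mem_filter] at hj
  refine ⟨Real.logb Q ‖x j‖ / D j, fun i hi => ?_, j, hj.1, hval hj.1 hj.2⟩
  by_cases hxi : x i = 0
  · rw [hxi, norm_zero]
    exact Real.rpow_nonneg hQ.le _
  · refine (hval hi hxi).trans_le (Real.rpow_le_rpow_of_exponent_ge hQ hQ1.le ?_)
    exact mul_le_mul_of_nonneg_right (hmin i (Finset.mem_filter.2 ⟨hi, hxi⟩)) (hD i hi).le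

/-- One large `ψ_k(0, d p^k)` suffices: `m'` is then taken as the least slope over the finitely many
nonzero values. -/
theorem RealDominant.of_exists {p : ℕ} [Fact p.Prime] {f : PowerSeries K} (hf : Admissible f)
    {k : ℕ} {m : ℝ}
    (hm : ∀ l < k, ∀ r s, p ^ l ∣ r → p ^ l ∣ s → r < s →
      ‖psi p f l r s‖ ≤ ‖1 - a f 0‖ ^ (m * ((s : ℝ) - r)))
    (hd : ∃ d ∈ Finset.Icc 1 (p - 1),
      ‖1 - a f 0‖ ^ ((m - (p : ℝ) ^ ((tau p f : ℤ) - 1)) * ((d * p ^ k : ℕ) : ℝ)) ≤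
        ‖psi p f k 0 (d * p ^ k)‖) :
    ∃ m', RealDominant p f k m m' := by
  have hQ := hf.q_pos
  have hD : ∀ d ∈ Finset.Icc 1 (p - 1), 0 < ((d * p ^ k : ℕ) : ℝ) := fun d hd => by
    rw [Finset.mem_Icc] at hd
    exact_mod_cast mul_pos hd.1 (pow_pos (Fact.out : p.Prime).pos k)
  obtain ⟨d, hd, hle⟩ := hd
  have hne : psi p f k 0 (d * p ^ k) ≠ 0 :=
    norm_pos_iff.1 ((Real.rpow_pos_of_pos hQ _).trans_le hle)
  obtain ⟨m', h1, h2⟩ := exists_min_slope (x := fun d => psi p f k 0 (d * p ^ k)) hQ hf.norm_lt hD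
    ⟨d, hd, hne⟩
  refine ⟨m', hm, ?_, h1, h2⟩
  have h3 := hle.trans (h1 d hd)
  rw [Real.rpow_le_rpow_left_iff_of_base_lt_one hQ hf.norm_lt] at h3
  exact le_of_mul_le_mul_right h3 (hD d hd)

section Slope

variable {f : PowerSeries K} {p : ℕ} {k r s : ℕ}

theorem slope_of_ne_zero (hψ : psi p f k r s ≠ 0) :
    slope p f k r s =
      ((Real.logb ‖1 - a f 0‖ ‖psi p f k r s‖ / ((s : ℝ) - r) : ℝ) : EReal) := by
  rw [slope, valMu, if_neg hψ, norm_sub_rev, EReal.coe_div]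
  rfl

theorem slope_of_eq_zero (h : r < s) (hψ : psi p f k r s = 0) : slope p f k r s = ⊤ := by
  rw [slope, valMu, if_pos hψ]
  refine EReal.top_div_of_pos_ne_top ?_ (EReal.coe_ne_top _)
  exact EReal.coe_pos.2 (sub_pos.2 (Nat.cast_lt.2 h))

theorem norm_psi_le_of_le_slope (hf : Admissible f) (h : r < s) {m : ℝ}
    (hm : (m : EReal) ≤ slope p f k r s) :
    ‖psi p f k r s‖ ≤ ‖1 - a f 0‖ ^ (m * ((s : ℝ) - r)) := by
  by_cases hψ : psi p f k r s = 0
  · rw [hψ, norm_zero]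
    exact Real.rpow_nonneg (norm_nonneg _) _
  rw [slope_of_ne_zero hψ, EReal.coe_le_coe_iff, le_div_iff₀ (sub_pos.2 (Nat.cast_lt.2 h))] at hm
  calc ‖psi p f k r s‖ = ‖1 - a f 0‖ ^ (Real.logb ‖1 - a f 0‖ ‖psi p f k r s‖) :=
        (Real.rpow_logb hf.q_pos hf.norm_lt.ne (norm_pos_iff.2 hψ)).symm
    _ ≤ _ := Real.rpow_le_rpow_of_exponent_ge hf.q_pos hf.norm_lt.le hm

theorem le_norm_psi_of_slope_le (hf : Admissible f) (h : r < s) {m : ℝ}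
    (hm : slope p f k r s ≤ (m : EReal)) :
    ‖1 - a f 0‖ ^ (m * ((s : ℝ) - r)) ≤ ‖psi p f k r s‖ := by
  by_cases hψ : psi p f k r s = 0
  · rw [slope_of_eq_zero h hψ] at hm
    exact absurd (top_le_iff.1 hm) (EReal.coe_ne_top _)
  rw [slope_of_ne_zero hψ, EReal.coe_le_coe_iff, div_le_iff₀ (sub_pos.2 (Nat.cast_lt.2 h))] at hm
  calc _ ≤ ‖1 - a f 0‖ ^ (Real.logb ‖1 - a f 0‖ ‖psi p f k r s‖) :=
        Real.rpow_le_rpow_of_exponent_ge hf.q_pos hf.norm_lt.le hm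
    _ = ‖psi p f k r s‖ := Real.rpow_logb hf.q_pos hf.norm_lt.ne (norm_pos_iff.2 hψ)

theorem slope_ne_bot (h : r < s) : slope p f k r s ≠ ⊥ := by
  by_cases hψ : psi p f k r s = 0
  · rw [slope_of_eq_zero h hψ]
    exact top_ne_bot
  · rw [slope_of_ne_zero hψ]
    exact EReal.coe_ne_bot _

theorem M_zero_ne_top [IsUltrametricDist K] [Fact p.Prime] (hf : Admissible f) :
    M p f 0 ≠ ⊤ := by
  obtain ⟨n, hn, ha⟩ := hf.exists_ne
  obtain ⟨j, rfl⟩ := u_mem hf.exists_ne n hn ha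
  have hj : 0 < j := Nat.pos_of_mul_pos_left hn
  have hψ : psi p f 0 0 j ≠ 0 := by
    rw [hf.psi_zero hj]
    refine div_ne_zero (by simpa using ha) (mul_ne_zero ?_ (pow_ne_zero _ hf.lam_ne))
    exact hf.one_sub_ne (pow_pos (Fact.out : p.Prime).pos _)
  have h1 : M p f 0 ≤ slope p f 0 0 j := sInf_le ⟨0, j, by simp, by simp, hj, rfl⟩
  rw [slope_of_ne_zero hψ] at h1
  exact ne_top_of_le_ne_top (EReal.coe_ne_top _) h1

theorem Dominant.exists_realDominant [IsUltrametricDist K] [Fact p.Prime] (hf : Admissible f)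
    (hk : 1 ≤ k) (hdom : Dominant p f k) : ∃ m m', RealDominant p f k m m' := by
  have hp := (Fact.out : p.Prime).two_le
  have hpos {d : ℕ} (hd : d ∈ Finset.Icc 1 (p - 1)) : 0 < d * p ^ k :=
    mul_pos (Finset.mem_Icc.1 hd).1 (pow_pos (Fact.out : p.Prime).pos k)
  rw [Dominant, ← Finset.inf_eq_iInf] at hdom
  obtain ⟨d, hd, hinf⟩ := Finset.exists_mem_eq_inf (Finset.Icc 1 (p - 1))
    ⟨1, Finset.mem_Icc.2 ⟨le_rfl, by omega⟩⟩ (fun d => slope p f k 0 (d * p ^ k))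
  rw [hinf] at hdom
  set R := ⨅ l ∈ Finset.range k, M p f l with hR
  -- The minimum of the `M_l` is real: `M_0 < ⊤` as some `aᵢ ≠ 0`, and the value `⊥` would force a
  -- single slope to be `⊥`.
  have hRtop : R ≠ ⊤ := ne_top_of_le_ne_top (M_zero_ne_top (p := p) hf)
    (iInf₂_le 0 (Finset.mem_range.2 hk))
  have hRbot : R ≠ ⊥ := by
    intro h
    rw [h, EReal.bot_sub] at hdom
    exact slope_ne_bot (hpos hd) (le_bot_iff.1 hdom)
  lift R to ℝ using ⟨hRtop, hRbot⟩ with m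
  refine ⟨m, RealDominant.of_exists hf (fun l hl r s hr hs h => ?_) ⟨d, hd, ?_⟩⟩
  · refine norm_psi_le_of_le_slope hf h ?_
    rw [hR]
    exact (iInf₂_le l (Finset.mem_range.2 hl)).trans (sInf_le ⟨r, s, hr, hs, h, rfl⟩)
  · rw [← EReal.coe_sub] at hdom
    simpa using le_norm_psi_of_slope_le hf (hpos hd) hdom

end Slope

end Dominance

/-! ### Dominance passes from level `k` to level `k + 1` -/

section Propagation

theorem sum_Ioo_mul {R : Type*} [AddCommMonoid R] (g : ℕ → R) (P : ℕ → Prop) [DecidablePred P]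
    {c : ℕ} (hc : 0 < c) (r s : ℕ) :
    ∑ x ∈ Finset.Ioo (c * r) (c * s) with c ∣ x ∧ P x, g x =
      ∑ i ∈ Finset.Ioo r s with P (c * i), g (c * i) := by
  refine Finset.sum_nbij' (fun x => x / c) (fun i => c * i) ?_ ?_ ?_ ?_ ?_
  · intro x hx
    simp only [Finset.mem_filter, Finset.mem_Ioo] at hx ⊢
    obtain ⟨⟨h1, h2⟩, ⟨i, rfl⟩, h3⟩ := hx
    rw [Nat.mul_div_cancel_left _ hc]
    exact ⟨⟨lt_of_mul_lt_mul_left h1 hc.le, lt_of_mul_lt_mul_left h2 hc.le⟩, h3⟩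
  · intro i hi
    simp only [Finset.mem_filter, Finset.mem_Ioo] at hi ⊢
    exact ⟨⟨Nat.mul_lt_mul_of_pos_left hi.1.1 hc, Nat.mul_lt_mul_of_pos_left hi.1.2 hc⟩,
      dvd_mul_right _ _, hi.2⟩
  · intro x hx
    simp only [Finset.mem_filter] at hx
    exact Nat.mul_div_cancel' hx.2.1
  · intro i _
    exact Nat.mul_div_cancel_left _ hc
  · intro x hx
    simp only [Finset.mem_filter] at hx
    rw [Nat.mul_div_cancel' hx.2.1]

variable {K : Type*} [NormedField K] [IsUltrametricDist K] {p : ℕ} [Fact p.Prime]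
  {m m' : ℝ} {f : PowerSeries K} {k : ℕ}

/-- The weights of the vertices `n p ^ k` in the recursion for `chi p f k 0`. -/
noncomputable def vertexWeight (p : ℕ) (f : PowerSeries K) (k n : ℕ) : K :=
  if n = 0 then 1 else if p ∣ n then 0 else chi p f k 0 (p ^ k * n) * kappa p f k (p ^ k * n)

theorem Admissible.chi_eq_sum (hf : Admissible f) (k : ℕ) {n : ℕ} (hn : 0 < n) :
    chi p f k 0 (p ^ k * n) =
      ∑ i ∈ Finset.range n, vertexWeight p f k i * psi p f k (p ^ k * i) (p ^ k * n) := by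
  have hpk : 0 < p ^ k := pow_pos (Fact.out : p.Prime).pos _
  have h1 := sum_Ioo_mul (fun x => chi p f k 0 x * kappa p f k x * psi p f k x (p ^ k * n))
    (fun x => ¬ p ^ (k + 1) ∣ x) hpk 0 n
  rw [mul_zero] at h1
  rw [hf.chi_rec k (mul_pos hpk hn), h1, Finset.range_eq_Ico, ← Finset.Ioo_insert_left hn,
    Finset.sum_insert (by simp), Finset.sum_filter]
  congr 1
  · simp [vertexWeight]
  · refine Finset.sum_congr rfl fun i hi => ?_
    rw [Finset.mem_Ioo] at hi
    have hdvd : p ^ (k + 1) ∣ p ^ k * i ↔ p ∣ i := by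
      rw [pow_succ, Nat.mul_dvd_mul_iff_left hpk]
    by_cases hpi : p ∣ i
    · rw [vertexWeight, if_neg hi.1.ne', if_pos hpi, if_neg (not_not.2 (hdvd.2 hpi)), zero_mul]
    · rw [vertexWeight, if_neg hi.1.ne', if_neg hpi, if_pos (mt hdvd.1 hpi)]

variable [CharP K p]

/-- On length at least `p^(k+1)` the gap `p^(τ-1)` is worth at least `p^(k+τ)`, which outweighs the
loss `p^(k+τ) - p^(k-1+τ)` from renormalization. -/
theorem RealDominant.norm_psi_lt (h : RealDominant p f k m m') (hf : Admissible f) (hk : 1 ≤ k)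
    {r s : ℕ} (hr : p ^ k ∣ r) (hs : p ^ k ∣ s) (hrs : r + p ^ (k + 1) ≤ s) :
    ‖psi p f k r s‖ < ‖1 - a f 0‖ ^ (m' * ((s : ℝ) - r)) := by
  obtain ⟨l, rfl⟩ : ∃ l, k = l + 1 := ⟨k - 1, by omega⟩
  have hp0 : (0 : ℝ) < p := by exact_mod_cast (Fact.out : p.Prime).pos
  have hpos : 0 < p ^ (l + 1 + 1) := pow_pos (Fact.out : p.Prime).pos _
  have hQ := hf.q_pos
  have hdvd : p ^ l ∣ p ^ (l + 1) := pow_dvd_pow p l.le_succ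
  have h1 := hf.norm_chi_le (h.bound l (Nat.lt_succ_self l)) r s (hdvd.trans hr) (hdvd.trans hs)
    (by omega)
  rw [hf.norm_psi_succ l r (by omega)]
  refine (mul_le_mul_of_nonneg_right h1 (Real.rpow_nonneg hQ.le _)).trans_lt ?_
  rw [← Real.rpow_add hQ]
  refine Real.rpow_lt_rpow_of_exponent_gt hQ hf.norm_lt ?_
  have hD : (p : ℝ) ^ (l + 1 + 1) ≤ (s : ℝ) - r := by
    rw [le_sub_iff_add_le]
    exact_mod_cast (by omega : p ^ (l + 1 + 1) + r ≤ s)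
  have hg : (0 : ℝ) < (p : ℝ) ^ ((tau p f : ℤ) - 1) := zpow_pos hp0 _
  have hgD : (p : ℝ) ^ ((tau p f : ℤ) - 1) * (p : ℝ) ^ (l + 1 + 1) = (p : ℝ) ^ (l + 1 + tau p f) := by
    rw [← zpow_natCast, ← zpow_natCast, ← zpow_add₀ hp0.ne']
    congr 1
    push_cast
    ring
  have h2 : (p : ℝ) ^ (l + 1 + tau p f) ≤ (p : ℝ) ^ ((tau p f : ℤ) - 1) * ((s : ℝ) - r) := by
    rw [← hgD]
    gcongr
  have h3 : 0 < (p : ℝ) ^ (l + tau p f) := pow_pos hp0 _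
  have hD0 : 0 ≤ (s : ℝ) - r := (pow_nonneg hp0.le _).trans hD
  have h4 := mul_le_mul_of_nonneg_right h.gap hD0
  rw [sub_mul] at h4
  linarith

theorem RealDominant.psi_shift_lt (h : RealDominant p f k m m') (hf : Admissible f) (hk : 1 ≤ k)
    (i : ℕ) {r s : ℕ} (hr : p ^ k ∣ r) (hs : p ^ k ∣ s) (hrs : r < s) :
    ‖psi p f k (r + p ^ k * i) (s + p ^ k * i) - psi p f k r s‖ <
      ‖1 - a f 0‖ ^ (m' * ((s : ℝ) - r)) := by
  refine (hf.psi_shift_le hk h.bound i k le_rfl r s hr hs hrs).trans_lt ?_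
  refine Real.rpow_lt_rpow_of_exponent_gt hf.q_pos hf.norm_lt ?_
  rw [sub_self, add_zero]
  exact mul_lt_mul_of_pos_right h.lt (sub_pos.2 (Nat.cast_lt.2 hrs))

/-- Long edges are negligible and short ones are close to their translates starting at `0`, so `m'`
bounds every slope at level `k`. -/
theorem RealDominant.norm_psi_le (h : RealDominant p f k m m') (hf : Admissible f) (hk : 1 ≤ k)
    (r s : ℕ) (hr : p ^ k ∣ r) (hs : p ^ k ∣ s) (hrs : r < s) :
    ‖psi p f k r s‖ ≤ ‖1 - a f 0‖ ^ (m' * ((s : ℝ) - r)) := by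
  by_cases hlarge : r + p ^ (k + 1) ≤ s
  · exact (h.norm_psi_lt hf hk hr hs hlarge).le
  obtain ⟨i, rfl⟩ := hr
  obtain ⟨j, rfl⟩ := hs
  have hpk : 0 < p ^ k := pow_pos (Fact.out : p.Prime).pos _
  have hij : i < j := lt_of_mul_lt_mul_left hrs hpk.le
  obtain ⟨d, rfl⟩ := Nat.exists_eq_add_of_le hij.le
  have hd : d ∈ Finset.Icc 1 (p - 1) := by
    rw [pow_succ, ← mul_add, Nat.mul_le_mul_left_iff hpk] at hlarge
    rw [Finset.mem_Icc]
    omega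
  have h1 := h.psi_shift_lt hf hk i (r := 0) (s := d * p ^ k) (dvd_zero _) (Dvd.intro_left d rfl)
    (mul_pos (by omega) hpk)
  have h2 := h.le d hd
  rw [zero_add, show d * p ^ k + p ^ k * i = p ^ k * (i + d) by ring] at h1
  have e : ((p ^ k * (i + d) : ℕ) : ℝ) - ((p ^ k * i : ℕ) : ℝ) = ((d * p ^ k : ℕ) : ℝ) := by
    push_cast
    ring
  rw [Nat.cast_zero, sub_zero] at h1
  rw [e, ← sub_add_cancel (psi p f k (p ^ k * i) (p ^ k * (i + d))) (psi p f k 0 (d * p ^ k))]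
  exact norm_add_le' h1.le h2

/-- Otherwise the vertex weights would satisfy the Euler equation approximately, with `w_d = ψ_k(0,
d p^k) / v`. -/
theorem RealDominant.exists_le_norm_chi (h : RealDominant p f k m m') (hf : Admissible f)
    (hk : 1 ≤ k) : ∃ d ∈ Finset.Icc 1 (p - 1),
      ‖1 - a f 0‖ ^ (m' * ((d * p ^ (k + 1) : ℕ) : ℝ)) ≤ ‖chi p f k 0 (d * p ^ (k + 1))‖ := by
  by_contra! hcon
  have hQ := hf.q_pos
  have hpk : 0 < p ^ k := pow_pos (Fact.out : p.Prime).pos _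
  set σ : ℝ := ‖1 - a f 0‖ ^ (m' * ((p ^ k : ℕ) : ℝ)) with hσdef
  have hσ : 0 < σ := Real.rpow_pos_of_pos hQ _
  have hσn (n : ℕ) : ‖1 - a f 0‖ ^ (m' * ((p ^ k * n : ℕ) : ℝ)) = σ ^ n := by
    rw [hσdef, ← Real.rpow_mul_natCast hQ.le]
    congr 1
    push_cast
    ring
  have hψ := h.norm_psi_le hf hk
  have hχ (n : ℕ) (hn : 0 < n) : ‖chi p f k 0 (p ^ k * n)‖ ≤ σ ^ n := by
    rw [← hσn]
    simpa using hf.norm_chi_le hψ 0 (p ^ k * n) (dvd_zero _) (dvd_mul_right _ _) (mul_pos hpk hn)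
  have hκ {n : ℕ} (hn : ¬ p ∣ n) : ‖kappa p f k (p ^ k * n)‖ = 1 :=
    hf.norm_kappa (dvd_mul_right _ _) (by rwa [pow_succ, Nat.mul_dvd_mul_iff_left hpk])
  have hy (n : ℕ) : ‖vertexWeight p f k n‖ ≤ σ ^ n := by
    rw [vertexWeight]
    split_ifs with h0 hpn
    · simp [h0]
    · simpa using pow_nonneg hσ.le n
    · rw [norm_mul, hκ hpn, mul_one]
      exact hχ n (Nat.pos_of_ne_zero h0)
  obtain ⟨v, hv, hpv⟩ := hf.u_eq p
  have hv1 : ‖(v : K)‖ = 1 := norm_natCast_eq_one p hpv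
  have hv0 : (v : K) ≠ 0 := by
    rw [← norm_ne_zero_iff, hv1]
    exact one_ne_zero
  refine not_approx_euler_eq p hσ (y := vertexWeight p f k)
    (w := fun d => (v : K)⁻¹ * psi p f k 0 (d * p ^ k)) (by simp [vertexWeight]) hy ?_ ?_ ?_
  · intro d hd
    rw [norm_mul, norm_inv, hv1, inv_one, one_mul, ← hσn, mul_comm (p ^ k)]
    exact h.le d hd
  · obtain ⟨d, hd, hd'⟩ := h.attained
    refine ⟨d, hd, ?_⟩
    rw [norm_mul, norm_inv, hv1, inv_one, one_mul, ← hσn, mul_comm (p ^ k)]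
    exact hd'
  · intro n hn
    rcases Nat.eq_zero_or_pos n with rfl | hn0
    · rw [Finset.sum_eq_zero]
      · simp
      · intro d hd
        simp only [Finset.mem_filter, Finset.mem_Icc] at hd
        omega
    have e1 : (n : K) * vertexWeight p f k n -
        ∑ d ∈ Finset.Icc 1 (p - 1) with d ≤ n,
          (v : K)⁻¹ * psi p f k 0 (d * p ^ k) * vertexWeight p f k (n - d) =
        (v : K)⁻¹ * ((((v * n : ℕ) : K) * vertexWeight p f k n - chi p f k 0 (p ^ k * n)) +
          (chi p f k 0 (p ^ k * n) - ∑ d ∈ Finset.Icc 1 (p - 1) with d ≤ n,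
            psi p f k 0 (d * p ^ k) * vertexWeight p f k (n - d))) := by
      simp_rw [mul_assoc]
      rw [← Finset.mul_sum]
      push_cast
      field_simp
      ring
    rw [e1, norm_mul, norm_inv, hv1, inv_one, one_mul]
    refine norm_add_lt ?_ ?_
    -- For `p ∣ n` the weight vanishes and `χ` is small by the contradiction hypothesis; otherwise
    -- `v n κ ≡ 1`.
    · by_cases hpn : p ∣ n
      · obtain ⟨d, rfl⟩ := hpn
        have hd : d ∈ Finset.Icc 1 (p - 1) := by
          have h1 : 0 < d := Nat.pos_of_mul_pos_left hn0
          rw [pow_two] at hn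
          have h2 : d < p := lt_of_mul_lt_mul_left hn (Nat.zero_le _)
          rw [Finset.mem_Icc]
          omega
        have h1 := hcon d hd
        rw [show d * p ^ (k + 1) = p ^ k * (p * d) by ring, hσn] at h1
        rw [vertexWeight, if_neg hn0.ne', if_pos (dvd_mul_right _ _), mul_zero, zero_sub, norm_neg]
        exact h1
      · have e2 : ((v * n : ℕ) : K) * vertexWeight p f k n - chi p f k 0 (p ^ k * n) =
            chi p f k 0 (p ^ k * n) * (((v * n : ℕ) : K) * kappa p f k (p ^ k * n) - 1) := by
          rw [vertexWeight, if_neg hn0.ne', if_neg hpn]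
          ring
        rw [e2, norm_mul]
        calc _ ≤ σ ^ n * ‖((v * n : ℕ) : K) * kappa p f k (p ^ k * n) - 1‖ := by
              gcongr
              exact hχ n hn0
          _ < σ ^ n * 1 := by
              gcongr
              exact hf.norm_kappa_mul_sub_lt hv hpv k hpn
          _ = σ ^ n := mul_one _
    · have e3 : chi p f k 0 (p ^ k * n) = ∑ d ∈ Finset.Icc 1 n,
          psi p f k (p ^ k * (n - d)) (p ^ k * n) * vertexWeight p f k (n - d) := by
        rw [hf.chi_eq_sum k hn0]
        refine Finset.sum_nbij' (fun i => n - i) (fun d => n - d) ?_ ?_ ?_ ?_ ?_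
        · intro i hi
          rw [Finset.mem_range] at hi
          rw [Finset.mem_Icc]
          omega
        · intro d hd
          rw [Finset.mem_Icc] at hd
          rw [Finset.mem_range]
          omega
        · intro i hi
          rw [Finset.mem_range] at hi
          omega
        · intro d hd
          rw [Finset.mem_Icc] at hd
          omega
        · intro i hi
          rw [Finset.mem_range] at hi
          rw [Nat.sub_sub_self hi.le, mul_comm]
      have e4 : ∑ d ∈ Finset.Icc 1 (p - 1) with d ≤ n,
            psi p f k 0 (d * p ^ k) * vertexWeight p f k (n - d) =
          ∑ d ∈ Finset.Icc 1 n, if d ≤ p - 1 then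
            psi p f k 0 (d * p ^ k) * vertexWeight p f k (n - d) else 0 := by
        rw [← Finset.sum_filter]
        refine Finset.sum_congr ?_ fun _ _ => rfl
        ext d
        simp only [Finset.mem_filter, Finset.mem_Icc]
        tauto
      rw [e3, e4, ← Finset.sum_sub_distrib]
      refine norm_sum_lt (pow_pos hσ _) fun d hd => ?_
      rw [Finset.mem_Icc] at hd
      have hlt {z : K} (hz : ‖z‖ < σ ^ d) : ‖z * vertexWeight p f k (n - d)‖ < σ ^ n := by
        rw [norm_mul]
        calc _ ≤ ‖z‖ * σ ^ (n - d) := by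
              gcongr
              exact hy _
          _ < σ ^ d * σ ^ (n - d) := by gcongr
          _ = σ ^ n := by rw [← pow_add, Nat.add_sub_cancel' hd.2]
      have hexp : ((p ^ k * n : ℕ) : ℝ) - ((p ^ k * (n - d) : ℕ) : ℝ) = ((p ^ k * d : ℕ) : ℝ) := by
        rw [Nat.mul_sub, Nat.cast_sub (Nat.mul_le_mul_left _ hd.2)]
        ring
      -- An edge of `d < p` units is replaced by its translate starting at `0`; a longer one is
      -- negligible.
      split_ifs with hdp
      · rw [← sub_mul]
        refine hlt ?_
        have h1 := h.psi_shift_lt hf hk (n - d) (r := 0) (s := d * p ^ k) (dvd_zero _)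
          (Dvd.intro_left d rfl) (mul_pos hd.1 hpk)
        rw [zero_add, show d * p ^ k + p ^ k * (n - d) = p ^ k * (d + (n - d)) by ring,
          Nat.add_sub_cancel' hd.2, Nat.cast_zero, sub_zero, mul_comm d, hσn] at h1
        rwa [mul_comm d]
      · rw [sub_zero]
        refine hlt ?_
        have h1 := h.norm_psi_lt hf hk (r := p ^ k * (n - d)) (s := p ^ k * n)
          (dvd_mul_right _ _) (dvd_mul_right _ _)
          (by
            rw [pow_succ, ← mul_add]
            exact Nat.mul_le_mul_left _ (by omega))
        rwa [hexp, hσn] at h1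

/-- Renormalization lowers the exponent by `(p-1) p^(k+τ)`. As `d ≤ p - 1`, this is at least
`p^(τ-1) · d p^(k+1)`, exactly the gap required at level `k + 1`. -/
theorem RealDominant.succ (h : RealDominant p f k m m') (hf : Admissible f) (hk : 1 ≤ k) :
    ∃ m'', RealDominant p f (k + 1) m' m'' := by
  have hQ := hf.q_pos
  have hp0 : (0 : ℝ) < p := by exact_mod_cast (Fact.out : p.Prime).pos
  obtain ⟨d, hd, hle⟩ := h.exists_le_norm_chi hf hk
  refine RealDominant.of_exists hf (fun l hl r s hr hs hrs => ?_) ⟨d, hd, ?_⟩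
  · rcases Nat.lt_succ_iff_lt_or_eq.1 hl with hl | rfl
    · refine (h.bound l hl r s hr hs hrs).trans
        (Real.rpow_le_rpow_of_exponent_ge hQ hf.norm_lt.le ?_)
      exact mul_le_mul_of_nonneg_right h.lt.le (sub_pos.2 (Nat.cast_lt.2 hrs)).le
    · exact h.norm_psi_le hf hk r s hr hs hrs
  · rw [Finset.mem_Icc] at hd
    rw [hf.norm_psi_succ k 0 (mul_pos hd.1 (pow_pos (Fact.out : p.Prime).pos _))]
    refine le_trans ?_ (mul_le_mul_of_nonneg_right hle (Real.rpow_nonneg hQ.le _))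
    rw [← Real.rpow_add hQ]
    refine Real.rpow_le_rpow_of_exponent_ge hQ hf.norm_lt.le ?_
    have hgD : (p : ℝ) ^ ((tau p f : ℤ) - 1) * ((d * p ^ (k + 1) : ℕ) : ℝ) =
        d * (p : ℝ) ^ (k + tau p f) := by
      push_cast
      rw [mul_left_comm, ← zpow_natCast, ← zpow_natCast, ← zpow_add₀ hp0.ne']
      congr 2
      push_cast
      ring
    have h1 : (d : ℝ) ≤ p - 1 := by
      rw [le_sub_iff_add_le]
      have := (Fact.out : p.Prime).pos
      exact_mod_cast (by omega : d + 1 ≤ p)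
    have h2 := mul_le_mul_of_nonneg_right h1 (pow_nonneg hp0.le (k + tau p f))
    have h3 : (p : ℝ) ^ (k + 1 + tau p f) = p * (p : ℝ) ^ (k + tau p f) := by ring
    rw [sub_mul, hgD, h3]
    linarith

theorem RealDominant.exists_le (h : RealDominant p f k m m') (hf : Admissible f) (hk : 1 ≤ k)
    (T : ℝ) : ∃ k' ≥ 1, ∃ n n', RealDominant p f k' n n' ∧ n' < T := by
  have hg : (0 : ℝ) < (p : ℝ) ^ ((tau p f : ℤ) - 1) :=
    zpow_pos (by exact_mod_cast (Fact.out : p.Prime).pos) _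
  have key (j : ℕ) : ∃ n n', RealDominant p f (k + j) n n' ∧
      n' ≤ m' - j * (p : ℝ) ^ ((tau p f : ℤ) - 1) := by
    induction j with
    | zero => exact ⟨m, m', h, by simp⟩
    | succ j ih =>
      obtain ⟨n, n', h1, h2⟩ := ih
      obtain ⟨n'', h3⟩ := h1.succ hf (by omega)
      refine ⟨n', n'', h3, ?_⟩
      have := h3.gap
      push_cast
      linarith
  obtain ⟨j, hj⟩ := exists_nat_gt ((m' - T) / (p : ℝ) ^ ((tau p f : ℤ) - 1))
  rw [div_lt_iff₀ hg] at hj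
  obtain ⟨n, n', h1, h2⟩ := key j
  exact ⟨k + j, by omega, n, n', h1, by linarith⟩

end Propagation

/-! ### The coefficients of a linearization -/

section Linearization

open PowerSeries

variable {K : Type*} [NormedField K]

theorem Phi_eq_zero {f : PowerSeries K} {r s : ℕ} (h : ¬ u f ∣ s - r) : Phi f r s = 0 := by
  have : I f r s = ∅ := by
    refine Finset.eq_empty_of_forall_notMem fun α hα => h ?_
    simp only [I, Finset.mem_filter] at hα
    rw [← hα.2.1]
    refine Finset.dvd_sum fun i _ => ?_
    by_cases hi : u f ∣ (i : ℕ)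
    · exact hi.mul_right _
    · rw [hα.2.2 i hi, mul_zero]
      exact dvd_zero _
  rw [Phi, this, Finset.sum_empty, mul_zero]

theorem subst_eq_of_linearization {f h g : PowerSeries K} (hf0 : constantCoeff f = 0)
    (hh0 : constantCoeff h = 0) (hg0 : constantCoeff g = 0)
    (hgh : subst h g = (X : PowerSeries K))
    (hlin : subst (subst g f : PowerSeries K) h = C (coeff 1 f) * (X : PowerSeries K)) :
    subst f h = C (coeff 1 f) * h := by
  have hh : HasSubst h := HasSubst.of_constantCoeff_zero' hh0
  have hg : HasSubst g := HasSubst.of_constantCoeff_zero' hg0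
  have hf : HasSubst f := HasSubst.of_constantCoeff_zero' hf0
  have hgf : HasSubst (subst g f : PowerSeries K) := by
    refine HasSubst.of_constantCoeff_zero' ?_
    exact constantCoeff_subst_eq_zero hg0 f hf0
  have h1 := congrArg (subst h) hlin
  rw [subst_comp_subst_apply hgf hh, subst_comp_subst_apply hg hh, hgh, subst_mul hh, subst_X hh]
    at h1
  rw [X_subst] at h1
  rw [h1, subst_C]
  rfl

theorem coeff_subst_eq_sum {f h : PowerSeries K} (hf0 : constantCoeff f = 0) (n : ℕ) :
    coeff n (subst f h : PowerSeries K) =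
      ∑ d ∈ Finset.range (n + 1), coeff d h * coeff n (f ^ d) := by
  rw [coeff_subst' (HasSubst.of_constantCoeff_zero' hf0),
    finsum_eq_sum_of_support_subset (s := Finset.range (n + 1))]
  · simp only [smul_eq_mul]
  · intro d hd
    by_contra hdn
    simp only [Finset.coe_range, Set.mem_Iio, not_lt] at hdn
    refine hd ?_
    simp only [smul_eq_mul]
    refine mul_eq_zero_of_right _ (coeff_of_lt_order _ ?_)
    exact lt_of_lt_of_le (Nat.cast_lt.2 (Nat.lt_of_succ_le hdn))
      (le_order_pow_of_constantCoeff_eq_zero d hf0)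

theorem eq_X_mul_mk {f : PowerSeries K} (hf0 : constantCoeff f = 0) :
    f = X * PowerSeries.mk (a f) := by
  ext n
  cases n with
  | zero => simpa using hf0
  | succ n => rw [coeff_succ_X_mul, coeff_mk, a]

theorem coeff_pow_eq {f : PowerSeries K} (hf0 : constantCoeff f = 0) {r n : ℕ} (h : r ≤ n) :
    coeff (n + 1) (f ^ (r + 1)) = coeff (n - r) (PowerSeries.mk (a f) ^ (r + 1)) := by
  conv_lhs => rw [eq_X_mul_mk hf0]
  rw [mul_pow, show n + 1 = (n - r) + (r + 1) by omega, coeff_X_pow_mul]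

/-- In the coefficient of `z^(n+1)` of `h ∘ f = λ h`, the term `r = n` is `λ^(n+1) bₙ`; solving for
`bₙ` produces the divisor `λ (1 - λ^n)`. -/
theorem linearization_rec [IsUltrametricDist K] {f h : PowerSeries K} (hf : Admissible f)
    (hf0 : constantCoeff f = 0) (hh0 : constantCoeff h = 0)
    (hfh : subst f h = C (a f 0) * h) {n : ℕ} (hn : 0 < n) :
    coeff (n + 1) h = ∑ r ∈ Finset.range n, coeff (r + 1) h * Phi f r n := by
  have h1 := congrArg (coeff (n + 1)) hfh
  have h2 : coeff (n - n) (PowerSeries.mk (a f) ^ (n + 1)) = a f 0 ^ (n + 1) := by simp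
  rw [coeff_subst_eq_sum hf0, coeff_C_mul, Finset.sum_range_succ', coeff_zero_eq_constantCoeff_apply,
    hh0, zero_mul, add_zero, Finset.sum_range_succ, coeff_pow_eq hf0 le_rfl, h2] at h1
  have h3 : ∑ r ∈ Finset.range n, coeff (r + 1) h * Phi f r n =
      1 / (a f 0 * (1 - a f 0 ^ n)) *
        ∑ r ∈ Finset.range n, coeff (r + 1) h * coeff (n + 1) (f ^ (r + 1)) := by
    rw [Finset.mul_sum]
    refine Finset.sum_congr rfl fun r hr => ?_
    rw [Phi_eq hf.exists_ne, coeff_pow_eq hf0 (Finset.mem_range.1 hr).le]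
    ring
  have h4 := hf.one_sub_ne hn
  have h5 := hf.lam_ne
  rw [h3, eq_sub_of_add_eq h1]
  field_simp
  ring

theorem linearization_rec_u [IsUltrametricDist K] {f h : PowerSeries K} (hf : Admissible f)
    (hf0 : constantCoeff f = 0) (hh0 : constantCoeff h = 0)
    (hfh : subst f h = C (a f 0) * h) {s : ℕ} (hs : 0 < s) :
    coeff (u f * s + 1) h =
      ∑ r ∈ Finset.range s, coeff (u f * r + 1) h * Phi f (u f * r) (u f * s) := by
  rw [linearization_rec hf hf0 hh0 hfh (mul_pos hf.u_pos hs)]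
  have hinj : Function.Injective (fun r => u f * r) := fun x y hxy =>
    Nat.eq_of_mul_eq_mul_left hf.u_pos hxy
  rw [← Finset.sum_image (s := Finset.range s) (g := fun r => u f * r)
    (f := fun r => coeff (r + 1) h * Phi f r (u f * s)) hinj.injOn]
  symm
  refine Finset.sum_subset ?_ fun r hr hr' => ?_
  · intro x hx
    obtain ⟨r, hr, rfl⟩ := Finset.mem_image.1 hx
    rw [Finset.mem_range] at hr ⊢
    exact Nat.mul_lt_mul_of_pos_left hr hf.u_pos
  · rw [Phi_eq_zero, mul_zero]
    intro hdvd
    rw [Finset.mem_range] at hr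
    obtain ⟨i, rfl⟩ := (Nat.dvd_sub_iff_right hr.le (dvd_mul_right _ _)).1 hdvd
    exact hr' (Finset.mem_image.2 ⟨i, Finset.mem_range.2
      (lt_of_mul_lt_mul_left hr (Nat.zero_le _)), rfl⟩)

theorem LocallyAnalytic.exists_bound {h : PowerSeries K} (hh : LocallyAnalytic h) {Q : ℝ}
    (hQ : 0 < Q) (hQ1 : Q < 1) {c : K} (v : ℕ) :
    ∃ T : ℝ, ∀ s : ℕ, 1 ≤ s → ‖coeff (v * s + 1) h / c‖ ≤ Q ^ (T * s) := by
  obtain ⟨ρ, hρ, hr⟩ := hh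
  rw [isRestricted_iff'] at hr
  obtain ⟨B, hB⟩ := hr.bddAbove_range
  have hB' (n : ℕ) : ‖coeff n h‖ * ρ ^ n ≤ B := hB ⟨n, rfl⟩
  set E : ℝ := max 1 (max (B * ρ⁻¹ / ‖c‖) ((ρ ^ v)⁻¹)) with hE
  have hE1 : 1 ≤ E := le_max_left _ _
  have hE2 : B * ρ⁻¹ / ‖c‖ ≤ E := (le_max_left _ _).trans (le_max_right _ _)
  have hE3 : (ρ ^ v)⁻¹ ≤ E := (le_max_right _ _).trans (le_max_right _ _)
  have hE0 : 0 < E := one_pos.trans_le hE1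
  -- One factor `E^s` bounds the geometric growth; the other absorbs the constant, as `1 ≤ s`.
  refine ⟨2 * Real.logb Q E, fun s hs => ?_⟩
  have e1 : Q ^ (2 * Real.logb Q E * s) = (E * E) ^ s := by
    rw [mul_right_comm, mul_comm, Real.rpow_mul hQ.le, Real.rpow_logb hQ hQ1.ne hE0, mul_comm (2 : ℝ),
      Real.rpow_mul hE0.le, Real.rpow_natCast, Real.rpow_ofNat, ← pow_mul, mul_comm s, pow_mul, sq]
  rw [e1, norm_div]
  calc ‖coeff (v * s + 1) h‖ / ‖c‖ ≤ (B / ρ ^ (v * s + 1)) / ‖c‖ := by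
        gcongr
        rw [le_div_iff₀ (pow_pos hρ _)]
        exact hB' _
    _ = (B * ρ⁻¹ / ‖c‖) * ((ρ ^ v)⁻¹) ^ s := by
        rw [pow_succ, pow_mul, inv_pow]
        field_simp
    _ ≤ E * E ^ s := by gcongr
    _ ≤ E ^ s * E ^ s := by
        gcongr
        exact le_self_pow₀ hE1 (by omega)
    _ = (E * E) ^ s := (mul_pow _ _ _).symm

/-- `B` is the sum over all chains from `0`. Splitting at the last vertex divisible by `p^k` gives
`φ_k(0, s) = B s - ∑ B x φ_k(x, s)`. Every term on the right is strictly below `Q ^ (m' s)`, yet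
`φ_k(0, s)` attains it for some `s = d p^k`. -/
theorem RealDominant.not_bounded [IsUltrametricDist K] {p : ℕ} [Fact p.Prime] [CharP K p]
    {f : PowerSeries K} {k : ℕ} {m m' T : ℝ} (h : RealDominant p f k m m') (hf : Admissible f)
    (hk : 1 ≤ k) (hT : m' < T) {B : ℕ → K}
    (hB : ∀ s, 0 < s → B s = Phi f (u f * 0) (u f * s) +
      ∑ x ∈ Finset.Ioo 0 s with ¬ False, B x * Phi f (u f * x) (u f * s))
    (hBT : ∀ s : ℕ, 1 ≤ s → ‖B s‖ ≤ ‖1 - a f 0‖ ^ (T * s)) : False := by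
  have hQ := hf.q_pos
  have hBlt (s : ℕ) (hs : 1 ≤ s) : ‖B s‖ < ‖1 - a f 0‖ ^ (m' * s) := by
    refine (hBT s hs).trans_lt (Real.rpow_lt_rpow_of_exponent_gt hQ hf.norm_lt ?_)
    exact mul_lt_mul_of_pos_right hT (by exact_mod_cast hs)
  obtain ⟨d, hd, hatt⟩ := h.attained
  rw [Finset.mem_Icc] at hd
  have hpk : 0 < p ^ k := pow_pos (Fact.out : p.Prime).pos _
  set s := d * p ^ k with hs
  have hs0 : 0 < s := mul_pos hd.1 hpk
  have hsk : p ^ k ∣ s := Dvd.intro_left d rfl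
  have hκ : ‖kappa p f k s‖ = 1 := by
    refine hf.norm_kappa hsk fun hdvd => ?_
    rw [hs, pow_succ, mul_comm d, Nat.mul_dvd_mul_iff_left hpk] at hdvd
    have := Nat.le_of_dvd hd.1 hdvd
    omega
  have hφ (r : ℕ) : ‖phi p f k r s‖ = ‖psi p f k r s‖ := by
    rw [hf.phi_eq k r hs0, norm_mul, hκ, mul_one]
  have hrec := rec_refine (P := fun x => p ^ k ∣ x) (P' := fun _ => False) (fun _ => False.elim)
    (phi_rec p f k) hB s hs0
  have h1 : ‖phi p f k 0 s‖ < ‖1 - a f 0‖ ^ (m' * (s : ℝ)) := by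
    rw [eq_sub_of_add_eq hrec.symm]
    refine norm_sub_lt (hBlt s hs0) (norm_sum_lt (Real.rpow_pos_of_pos hQ _) fun x hx => ?_)
    simp only [Finset.mem_filter, Finset.mem_Ioo] at hx
    obtain ⟨⟨hx0, hxs⟩, hxk, -⟩ := hx
    rw [norm_mul, hφ, show m' * (s : ℝ) = m' * x + m' * ((s : ℝ) - x) by ring, Real.rpow_add hQ]
    exact mul_lt_mul_of_lt_of_le_of_nonneg_of_pos (hBlt x hx0)
      (h.norm_psi_le hf hk x s hxk hsk hxs) (norm_nonneg _) (Real.rpow_pos_of_pos hQ _)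
  rw [hφ, hatt] at h1
  exact lt_irrefl _ h1

end Linearization

end NonLin

/-! ### Conclusion -/

theorem mainTheorem1 {K : Type*} [NormedField K] [IsUltrametricDist K] [CompleteSpace K]
    (p : ℕ) [Fact p.Prime] (hp : 3 ≤ p) [CharP K p]
    (lam : K) (hroot : ∀ n : ℕ, 1 ≤ n → lam ^ n ≠ 1) (hlam : ‖1 - lam‖ < 1)
    (f : PowerSeries K) (hf0 : PowerSeries.constantCoeff f = 0)
    (hf1 : PowerSeries.coeff 1 f = lam) (hfan : NonLin.LocallyAnalytic f)
    (hfne : ∃ i : ℕ, 1 ≤ i ∧ PowerSeries.coeff (i + 1) f ≠ 0)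
    (k : ℕ) (hk : 1 ≤ k) (hdom : NonLin.Dominant p f k) :
    ¬ NonLin.Linearizable f := by
  subst hf1
  have hf : NonLin.Admissible f := ⟨hfne, hroot, hlam⟩
  rintro ⟨h, g, hh, hh0, hg0, hhg, hgh, hlin⟩
  have hfh := NonLin.subst_eq_of_linearization hf0 hh0 hg0 hgh hlin
  -- Invertibility of `h` under composition allows normalizing by `b₀`.
  have hc : PowerSeries.coeff 1 h ≠ 0 := by
    intro h1
    have h2 := congrArg (PowerSeries.coeff 1) hhg
    rw [NonLin.coeff_subst_eq_sum hg0, Finset.sum_range_succ, Finset.sum_range_succ, h1] at h2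
    simp [hh0] at h2
  obtain ⟨T, hT⟩ := hh.exists_bound hf.q_pos hf.norm_lt (c := PowerSeries.coeff 1 h) (NonLin.u f)
  obtain ⟨m, m', hm⟩ := hdom.exists_realDominant hf hk
  obtain ⟨k', hk', n, n', hn, hnT⟩ := hm.exists_le hf hk T
  refine hn.not_bounded hf hk' hnT
    (B := fun s => PowerSeries.coeff (NonLin.u f * s + 1) h / PowerSeries.coeff 1 h)
    (fun s hs => ?_) hT
  rw [NonLin.linearization_rec_u hf hf0 hh0 hfh hs, Finset.range_eq_Ico,
    ← Finset.Ioo_insert_left hs, Finset.sum_insert (by simp), add_div, mul_zero, zero_add,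
    mul_div_cancel_left₀ _ hc, Finset.sum_div]
  simp only [not_false_eq_true, Finset.filter_true]
  congr 1
  exact Finset.sum_congr rfl fun x _ => mul_div_right_comm _ _ _
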